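/- Let $D\ge 0$ be an integer, let $\Theta\subseteq\mathbb{R}^D$ be measurable, let $E\subseteq\Theta$ be open in $\mathbb{R}^D$ and bounded, and let $\theta_0\in E$. Let $\pi:\Theta\to\mathbb{R}$ be a probability density with respect to Lebesgue measure that is continuous at $\theta_0$ with $\pi(\theta_0)>0$. For $n\in\{1,2,\dots\}$ let $f_n:\Theta\to\mathbb{R}$ be a measurable function with continuous third derivatives on $E$. Suppose that $f_n\to f$ pointwise on $\Theta$ for some $f:\Theta\to\mathbb{R}$, that the Hessian $f''(\theta_0)$ is positive definite, and that the tensors of third derivatives $(f_n''')$ are uniformly bounded on $E$, i.e. $\sup_{n\ge1}\sup_{\theta\in E}\|f_n'''(\theta)\|<\infty$. Consider the following two conditions: (1) for some compact $K\subseteq E$ with $\theta_0$ in the interior of $K$, $f(\theta)>f(\theta_0)$ for all $\theta\in K\setminus\{\theta_0\}$ and $\liminf_n\inf_{\theta\in\Theta\setminus K}f_n(\theta)>f(\theta_0)$; (2) each $f_n$ is convex, in the sense that $f_n(t\theta+(1-t)\theta')\le t f_n(\theta)+(1-t)f_n(\theta')$ whenever $\theta,\theta'\in\Theta$, $t\in[0,1]$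 and $t\theta+(1-t)\theta'\in\Theta$; and $f'(\theta_0)=0$. Let $H_0=f''(\theta_0)$, $z_n=\int_\Theta e^{-nf_n(\theta)}\pi(\theta)\,d\theta$, and $\pi_n(\theta)=e^{-nf_n(\theta)}\pi(\theta)/z_n$ for $\theta\in\Theta$, $\pi_n(\theta)=0$ for $\theta\in\mathbb{R}^D\setminus\Theta$. If (1) or (2) holds, then $0<z_n<\infty$ for all sufficiently large $n$, and there is a sequence $\theta_n\in\Theta$ with $\theta_n\to\theta_0$ such that $f_n'(\theta_n)=0$ for all sufficiently large $n$, $f_n(\theta_n)\to f(\theta_0)$, and (a) (concentration) for every $\epsilon>0$, $\int_{B_\epsilon(\theta_0)}\pi_n(\theta)\,d\theta\to1$ as $n\to\infty$, where $B_\epsilon(\theta_0)$ is the open Euclidean ball of radius $\epsilon$ about $\theta_0$; (b) (Laplace approximation) $$z_n\sim\frac{e^{-nf_n(\theta_n)}\pi(\theta_0)}{|\det H_0|^{1/2}}\Big(\frac{2\pi}{n}\Big)^{D/2}\quad\text{as }n\to\infty,$$ i.e. the ratio of the two sides tends to $1$ (in $2\pi/n$, $\pi$ is the circle constant); (c) (asymptotic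 normality in total variation) if $q_n$ is the density of $\sqrt n(\theta-\theta_n)$ when $\theta$ has density $\pi_n$, then $$\int_{\mathbb{R}^D}\big|q_n(x)-\mathcal{N}(x\mid0,H_0^{-1})\big|\,dx\to0\quad\text{as }n\to\infty,$$ where $\mathcal{N}(x\mid\mu,C)$ is the normal density with mean $\mu$ and covariance matrix $C$. Moreover, under the assumptions preceding (1) and (2), condition (2) implies condition (1). -/

import Mathlib

open MeasureTheory Filter Topology

noncomputable section

namespace GenPosterior

/-- `D`-dimensional Euclidean space. -/
abbrev Euc (D : ℕ) : Type := EuclideanSpace ℝ (Fin D)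

/-- The `i`-th standard basis vector. -/
def e {D : ℕ} (i : Fin D) : Euc D := EuclideanSpace.single i 1

/-- The Hessian matrix `f''(x)`, with entries `∂²f / ∂x_i ∂x_j`. -/
def hessian {D : ℕ} (f : Euc D → ℝ) (x : Euc D) : Matrix (Fin D) (Fin D) ℝ :=
  Matrix.of fun i j => iteratedFDeriv ℝ 2 f x ![e i, e j]

/-- The tensor `f'''(x)` of third derivatives, with entries `∂³f / ∂x_i ∂x_j ∂x_k`. -/
def thirdDeriv {D : ℕ} (f : Euc D → ℝ) (x : Euc D) (i j k : Fin D) : ℝ :=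
  iteratedFDeriv ℝ 3 f x ![e i, e j, e k]

/-- The Euclidean (Frobenius) norm of a tensor in `ℝ^(D³)`. -/
def tensorNorm {D : ℕ} (T : Fin D → Fin D → Fin D → ℝ) : ℝ :=
  Real.sqrt (∑ i, ∑ j, ∑ k, T i j k ^ 2)

/-- Convexity of a real function on a set that need not be convex: the convexity inequality is
required whenever the convex combination lies in the set. -/
def IsConvexFun {D : ℕ} (Θ : Set (Euc D)) (f : Euc D → ℝ) : Prop :=
  ∀ x ∈ Θ, ∀ y ∈ Θ, ∀ t ∈ Set.Icc (0 : ℝ) 1, t • x + (1 - t) • y ∈ Θ →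
    f (t • x + (1 - t) • y) ≤ t * f x + (1 - t) * f y

/-- `p` is (on `Θ`) a probability density with respect to Lebesgue measure. -/
structure IsProbDensityOn {D : ℕ} (Θ : Set (Euc D)) (p : Euc D → ℝ) : Prop where
  measurable : Measurable fun θ : Θ => p θ
  nonneg : ∀ θ ∈ Θ, 0 ≤ p θ
  lintegral_eq_one : ∫⁻ θ in Θ, ENNReal.ofReal (p θ) = 1

/-- The normalizing constant `z_n = ∫_Θ exp (-n f_n(θ)) p(θ) dθ`; here `g` is `f_n`. -/
def normConst {D : ℕ} (Θ : Set (Euc D)) (p : Euc D → ℝ) (g : Euc D → ℝ) (n : ℕ) : ℝ :=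
  ∫ θ in Θ, Real.exp (-(n : ℝ) * g θ) * p θ

/-- The posterior density `exp (-n f_n(θ)) p(θ) / z_n` on `Θ`, extended by zero to `ℝ^D`. -/
def postDensity {D : ℕ} (Θ : Set (Euc D)) (p : Euc D → ℝ) (g : Euc D → ℝ) (n : ℕ) :
    Euc D → ℝ :=
  Θ.indicator fun θ => Real.exp (-(n : ℝ) * g θ) * p θ / normConst Θ p g n

/-- The distribution on `ℝ^D` with density `postDensity`. -/
def postMeasure {D : ℕ} (Θ : Set (Euc D)) (p : Euc D → ℝ) (g : Euc D → ℝ) (n : ℕ) :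
    Measure (Euc D) :=
  volume.withDensity fun θ => ENNReal.ofReal (postDensity Θ p g n θ)

/-- The Lebesgue density of `√n (θ - c)` when `θ` has density `postDensity`. -/
def rescaledDensity {D : ℕ} (Θ : Set (Euc D)) (p : Euc D → ℝ) (g : Euc D → ℝ) (n : ℕ)
    (c : Euc D) (x : Euc D) : ℝ :=
  (((postMeasure Θ p g n).map fun θ => Real.sqrt n • (θ - c)).rnDeriv volume x).toReal

/-- The density at `x` of the normal distribution with mean `μ` and covariance matrix `C`. -/
def normalDensity {D : ℕ} (μ : Euc D) (C : Matrix (Fin D) (Fin D) ℝ) (x : Euc D) : ℝ :=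
  Real.exp (-(1 / 2) * ((x - μ).ofLp ⬝ᵥ (C⁻¹.mulVec (x - μ).ofLp))) /
    ((2 * Real.pi) ^ ((D : ℝ) / 2) * Real.sqrt C.det)

/-- The separation condition: for some compact `K ⊆ E` with `θ₀` in its interior,
`f > f(θ₀)` on `K \ {θ₀}` and `liminf_n inf_{Θ \ K} f_n > f(θ₀)` (in the extended reals). -/
def SeparationCond {D : ℕ} (Θ E : Set (Euc D)) (θ₀ : Euc D) (fn : ℕ → Euc D → ℝ)
    (f : Euc D → ℝ) : Prop :=
  ∃ K : Set (Euc D), IsCompact K ∧ K ⊆ E ∧ θ₀ ∈ interior K ∧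
    (∀ θ ∈ K \ {θ₀}, f θ₀ < f θ) ∧
    (f θ₀ : EReal) < liminf (fun n => ⨅ θ ∈ Θ \ K, (fn n θ : EReal)) atTop

/-- The convexity condition: every `f_n`, `n ≥ 1`, is convex on `Θ`, and `f'(θ₀) = 0`. -/
def ConvexCond {D : ℕ} (Θ : Set (Euc D)) (θ₀ : Euc D) (fn : ℕ → Euc D → ℝ)
    (f : Euc D → ℝ) : Prop :=
  (∀ n, 1 ≤ n → IsConvexFun Θ (fn n)) ∧ HasGradientAt f 0 θ₀

end GenPosterior

end

/-! This is Laplace's method, made uniform in `n` by the bound on the third derivatives. That bound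
makes the second derivatives `f_n''` equi-Lipschitz near each point of `E`. Since `f_n` converges
pointwise, symmetric second differences stay bounded, so `f_n''` is bounded at one point and hence
on a ball, and `f_n'` is equi-Lipschitz too. Difference quotients then show that `f_n'` and `f_n''`
converge to the derivatives of `f`, and that `f_n` and `f_n''` converge jointly in the index and the
point (`tendsto_fderiv_of_bounded_third`).

Under separation, minimisers of `f_n` over a fixed ball are forced towards `θ₀`; these are the
`θ_n`. Being critical points, they give an expansion of `f_n` about `θ_n` with no linear term and
with quadratic form as close to `f''(θ₀)` as desired, uniformly in `n`
(`exists_quadratic_expansion`). Off each ball, `f_n` exceeds `f_n(θ_n)` by a fixed margin.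
`LaplaceSetting` records exactly these facts.

In the coordinate `x = √n (θ - θ_n)`, the weight divided by `exp (-n f_n(θ_n))` converges in `L¹` to
`p(θ₀) exp (-S(x, x) / 2)`, where `S = f''(θ₀)`: by domination near the origin, and because the far
part has mass at most `√n ^ D exp (-n η)` (`tendsto_integral_abs_sub`). Integrating this gives the
asymptotics of `z_n`, normalizing it gives total variation convergence, and the margin gives
concentration.

Convexity reduces to separation: a margin on a small sphere propagates outward along rays from `θ₀`.
-/

noncomputable section

namespace GenPosterior

set_option maxSynthPendingDepth 3

/-! ### Convergence of derivatives under a third-derivative bound -/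

/-- Equi-Lipschitz sequences that converge at a point converge jointly there. -/
theorem tendsto_prod_of_equiLipschitz {V W : Type*} [NormedAddCommGroup V] [NormedAddCommGroup W]
    {h : ℕ → V → W} {x : V} {R C : ℝ} {c : W} (hR : 0 < R)
    (hL : ∀ᶠ n in atTop, ∀ y ∈ Metric.ball x R, ∀ z ∈ Metric.ball x R,
      ‖h n y - h n z‖ ≤ C * ‖y - z‖)
    (hx : Tendsto (fun n => h n x) atTop (𝓝 c)) :
    Tendsto (fun q : ℕ × V => h q.1 q.2) (atTop ×ˢ 𝓝 x) (𝓝 c) := by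
  have h1 : Tendsto (fun q : ℕ × V => h q.1 x) (atTop ×ˢ 𝓝 x) (𝓝 c) := hx.comp tendsto_fst
  have h2 : Tendsto (fun q : ℕ × V => C * ‖q.2 - x‖) (atTop ×ˢ 𝓝 x) (𝓝 0) := by
    have : Tendsto (fun y : V => C * ‖y - x‖) (𝓝 x) (𝓝 0) := by
      have : Continuous fun y : V => C * ‖y - x‖ := by fun_prop
      simpa using this.tendsto x
    exact this.comp tendsto_snd
  have h3 : Tendsto (fun q : ℕ × V => h q.1 q.2 - h q.1 x) (atTop ×ˢ 𝓝 x) (𝓝 0) := by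
    refine squeeze_zero_norm' ?_ h2
    filter_upwards [hL.prod_mk (Metric.ball_mem_nhds x hR)] with q hq
    exact hq.1 _ hq.2 _ (Metric.mem_ball_self hR)
  simpa using h3.add h1

section Regularity

variable {V W : Type*} [NormedAddCommGroup V] [NormedSpace ℝ V]
  [NormedAddCommGroup W] [NormedSpace ℝ W]

/-- Second order Taylor estimate from a first order estimate of the derivative. -/
theorem abs_taylor_two_le {f : V → ℝ} {x v : V} {S : V →L[ℝ] V →L[ℝ] ℝ} {K r : ℝ} (hK : 0 ≤ K)
    (hf : ∀ w, ‖w‖ < r → DifferentiableAt ℝ f (x + w))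
    (hS : ∀ w, ‖w‖ < r → ‖fderiv ℝ f (x + w) - fderiv ℝ f x - S w‖ ≤ K * ‖w‖) (hv : ‖v‖ < r) :
    |f (x + v) - f x - fderiv ℝ f x v - 1 / 2 * S v v| ≤ K * ‖v‖ ^ 2 := by
  have hn : ∀ t ∈ Set.Icc (0 : ℝ) 1, ‖t • v‖ ≤ ‖v‖ := by
    intro t ht
    rw [norm_smul, Real.norm_of_nonneg ht.1]
    nlinarith [norm_nonneg v, ht.2]
  -- The mean value inequality is applied on `[0, 1]` to the Taylor remainder along the segment. Its
  -- derivative is the first-order remainder at `t • v` applied to `v`; bounding `‖t • v‖` by `‖v‖`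
  -- only costs a factor in the constant.
  have hd : ∀ t ∈ Set.Icc (0 : ℝ) 1, HasDerivWithinAt
      (fun t : ℝ => f (x + t • v) - t * fderiv ℝ f x v - t ^ 2 / 2 * S v v)
      (fderiv ℝ f (x + t • v) v - fderiv ℝ f x v - t * S v v) (Set.Icc 0 1) t := by
    intro t ht
    have h1 : HasDerivAt (fun t : ℝ => x + t • v) v t := by
      simpa using ((hasDerivAt_id t).smul_const v).const_add x
    have h2 := (hf (t • v) ((hn t ht).trans_lt hv)).hasFDerivAt.comp_hasDerivAt t h1
    have h3 := (hasDerivAt_id t).mul_const (fderiv ℝ f x v)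
    have h4 := (((hasDerivAt_id t).pow 2).div_const 2).mul_const (S v v)
    refine HasDerivAt.hasDerivWithinAt ?_
    refine ((h2.sub h3).sub h4).congr_deriv ?_
    simp
  have hb : ∀ t ∈ Set.Ico (0 : ℝ) 1,
      ‖fderiv ℝ f (x + t • v) v - fderiv ℝ f x v - t * S v v‖ ≤ K * ‖v‖ ^ 2 := by
    intro t ht
    have ht' : t ∈ Set.Icc (0 : ℝ) 1 := ⟨ht.1, ht.2.le⟩
    have h1 := hS (t • v) ((hn t ht').trans_lt hv)
    have h2 := (fderiv ℝ f (x + t • v) - fderiv ℝ f x - S (t • v)).le_opNorm v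
    simp only [map_smul, sub_apply, smul_apply,
      smul_eq_mul] at h1 h2
    refine h2.trans ?_
    have h3 : K * ‖t • v‖ ≤ K * ‖v‖ := mul_le_mul_of_nonneg_left (hn t ht') hK
    nlinarith [norm_nonneg v]
  have := norm_image_sub_le_of_norm_deriv_le_segment_01' hd hb
  simp only [one_smul, zero_smul, add_zero, Real.norm_eq_abs] at this
  convert this using 2
  ring

/-- A sequence of continuous linear maps on a finite-dimensional space that is pointwise Cauchy
is Cauchy. -/
theorem cauchySeq_clm_of_apply [FiniteDimensional ℝ V] {T : ℕ → V →L[ℝ] W}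
    (h : ∀ u, CauchySeq fun n => T n u) : CauchySeq T := by
  obtain ⟨C, hC, hb⟩ := (Module.finBasis ℝ V).exists_opNorm_le (F := W)
  rw [Metric.cauchySeq_iff]
  intro ε hε
  have h1 : ∀ i, ∃ N, ∀ m ≥ N, ∀ n ≥ N,
      dist (T m (Module.finBasis ℝ V i)) (T n (Module.finBasis ℝ V i)) < ε / (2 * C) := fun i =>
    Metric.cauchySeq_iff.1 (h _) _ (by positivity)
  choose N hN using h1
  refine ⟨Finset.univ.sup N, fun m hm n hn => ?_⟩
  rw [dist_eq_norm]
  have := hb (u := T m - T n) (M := ε / (2 * C)) (by positivity) (fun i => by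
    have := hN i m ((Finset.le_sup (Finset.mem_univ i)).trans hm) n
      ((Finset.le_sup (Finset.mem_univ i)).trans hn)
    rw [dist_eq_norm] at this
    simpa using this.le)
  refine this.trans_lt ?_
  rw [show C * (ε / (2 * C)) = ε / 2 by field_simp]
  linarith

/-- If a family of continuous linear maps on a finite-dimensional space is eventually bounded at
each point, then it is eventually bounded in operator norm. -/
theorem eventually_norm_clm_le_of_apply [FiniteDimensional ℝ V] {T : ℕ → V →L[ℝ] W}
    (h : ∀ u, ∃ M, ∀ᶠ n in atTop, ‖T n u‖ ≤ M) : ∃ M, ∀ᶠ n in atTop, ‖T n‖ ≤ M := by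
  obtain ⟨C, hC, hb⟩ := (Module.finBasis ℝ V).exists_opNorm_le (F := W)
  choose M hM using fun i => h (Module.finBasis ℝ V i)
  refine ⟨C * ∑ i, |M i|, ?_⟩
  filter_upwards [eventually_all.2 hM] with n hn
  refine hb (Finset.sum_nonneg fun i _ => abs_nonneg _) fun i => (hn i).trans ?_
  exact (le_abs_self _).trans
    (Finset.single_le_sum (f := fun i => |M i|) (fun i _ => abs_nonneg _) (Finset.mem_univ i))

/-- Pointwise convergence of functions with equi-Lipschitz derivatives entails pointwise
convergence of the derivatives. -/
theorem differentiableAt_and_tendsto_fderiv_of_equiLipschitz [FiniteDimensional ℝ V]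
    [CompleteSpace W] {g : ℕ → V → W} {G : V → W} {x : V} {R C : ℝ}
    (hg : ∀ᶠ n in atTop, ∀ y ∈ Metric.ball x R, DifferentiableAt ℝ (g n) y)
    (hL : ∀ᶠ n in atTop, ∀ y ∈ Metric.ball x R, ∀ z ∈ Metric.ball x R,
      ‖fderiv ℝ (g n) y - fderiv ℝ (g n) z‖ ≤ C * ‖y - z‖)
    (hlim : ∀ y ∈ Metric.ball x R, Tendsto (fun n => g n y) atTop (𝓝 (G y))) :
    ∀ y ∈ Metric.ball x R, DifferentiableAt ℝ G y ∧
      Tendsto (fun n => fderiv ℝ (g n) y) atTop (𝓝 (fderiv ℝ G y)) := by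
  wlog hC : 0 ≤ C generalizing C
  · refine this (C := 0) ?_ le_rfl
    filter_upwards [hL] with n hn y hy z hz
    refine (hn y hy z hz).trans (mul_le_mul_of_nonneg_right (not_le.1 hC).le (norm_nonneg _))
  -- difference quotients
  have key : ∀ y ∈ Metric.ball x R, ∀ u : V, ∃ t₀ > 0, ∀ t, 0 < t → t < t₀ →
      y + t • u ∈ Metric.ball x R ∧ ∀ᶠ n in atTop,
        ‖t⁻¹ • (g n (y + t • u) - g n y) - fderiv ℝ (g n) y u‖ ≤ t * (C * ‖u‖ ^ 2) := by
    intro y hy u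
    have hc : Tendsto (fun t : ℝ => y + t • u) (𝓝 0) (𝓝 y) := by
      have : Continuous fun t : ℝ => y + t • u := by fun_prop
      simpa using this.tendsto 0
    obtain ⟨t₀, ht₀, hb⟩ := Metric.eventually_nhds_iff.1
      (hc.eventually (Metric.isOpen_ball.mem_nhds hy))
    refine ⟨t₀, ht₀, fun t ht htt => ?_⟩
    have hmem : y + t • u ∈ Metric.ball x R := hb (by simpa [abs_of_pos ht] using htt)
    refine ⟨hmem, ?_⟩
    filter_upwards [hg, hL] with n hn hLn
    have hseg : segment ℝ y (y + t • u) ⊆ Metric.ball x R :=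
      (convex_ball x R).segment_subset hy hmem
    -- On this segment the derivative differs from its value at `y` by at most `C * (t * ‖u‖)`, so
    -- the quotient error is of order `t`, uniformly in `n`.
    have h1 := (convex_segment (𝕜 := ℝ) y (y + t • u)).norm_image_sub_le_of_norm_hasFDerivWithin_le'
      (f := g n) (f' := fderiv ℝ (g n)) (φ := fderiv ℝ (g n) y) (C := C * (t * ‖u‖))
      (fun z hz => (hn z (hseg hz)).hasFDerivAt.hasFDerivWithinAt)
      (fun z hz => by
        refine (hLn z (hseg hz) y hy).trans (mul_le_mul_of_nonneg_left ?_ hC)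
        have := norm_sub_le_of_mem_segment hz
        simpa [norm_smul, abs_of_pos ht] using this)
      (left_mem_segment ℝ _ _) (right_mem_segment ℝ _ _)
    have h2 : t⁻¹ • (g n (y + t • u) - g n y) - fderiv ℝ (g n) y u
        = t⁻¹ • (g n (y + t • u) - g n y - fderiv ℝ (g n) y (y + t • u - y)) := by
      rw [smul_sub t⁻¹ (g n (y + t • u) - g n y)]
      simp [smul_smul, ht.ne']
    rw [h2, norm_smul, norm_inv, Real.norm_of_nonneg ht.le, inv_mul_le_iff₀ ht]
    refine h1.trans (le_of_eq ?_)
    simp [norm_smul, abs_of_pos ht]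
    ring
  -- For one small fixed `t` the quotients are Cauchy in `n`, because `g n` converges at both
  -- endpoints, and each is within `ε / 3` of the directional derivative.
  have hcau : ∀ y ∈ Metric.ball x R, CauchySeq fun n => fderiv ℝ (g n) y := by
    intro y hy
    refine cauchySeq_clm_of_apply fun u => ?_
    rw [Metric.cauchySeq_iff']
    intro ε hε
    obtain ⟨t₀, ht₀, hk⟩ := key y hy u
    obtain ⟨t, ht, htt⟩ : ∃ t, 0 < t ∧ t < t₀ ∧ t * (C * ‖u‖ ^ 2) < ε / 3 := by
      have hc : Tendsto (fun t : ℝ => t * (C * ‖u‖ ^ 2)) (𝓝[>] 0) (𝓝 0) := by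
        have : Continuous fun t : ℝ => t * (C * ‖u‖ ^ 2) := by fun_prop
        simpa using (this.tendsto 0).mono_left nhdsWithin_le_nhds
      have h1 := hc.eventually (gt_mem_nhds (show 0 < ε / 3 by positivity))
      have h2 : ∀ᶠ t : ℝ in 𝓝[>] 0, t ∈ Set.Ioo 0 t₀ := Ioo_mem_nhdsGT ht₀
      obtain ⟨t, h3, h4⟩ := (h1.and h2).exists
      exact ⟨t, h4.1, h4.2, h3⟩
    obtain ⟨hmem, hq⟩ := hk t ht htt.1
    have hqc : CauchySeq fun n => t⁻¹ • (g n (y + t • u) - g n y) :=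
      (((hlim _ hmem).sub (hlim y hy)).const_smul t⁻¹).cauchySeq
    obtain ⟨N₁, hN₁⟩ := Metric.cauchySeq_iff.1 hqc (ε / 3) (by positivity)
    obtain ⟨N₂, hN₂⟩ := eventually_atTop.1 hq
    refine ⟨max N₁ N₂, fun n hn => ?_⟩
    have a1 := hN₁ n (le_trans (le_max_left _ _) hn) (max N₁ N₂) (le_max_left _ _)
    have a2 := hN₂ n (le_trans (le_max_right _ _) hn)
    have a3 := hN₂ (max N₁ N₂) (le_max_right _ _)
    rw [← dist_eq_norm] at a2 a3
    rw [dist_comm] at a2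
    have := dist_triangle4 (fderiv ℝ (g n) y u) (t⁻¹ • (g n (y + t • u) - g n y))
      (t⁻¹ • (g (max N₁ N₂) (y + t • u) - g (max N₁ N₂) y)) (fderiv ℝ (g (max N₁ N₂)) y u)
    linarith [htt.2]
  choose! G' hG' using fun y hy => cauchySeq_tendsto_of_complete (hcau y hy)
  -- The Lipschitz bound survives in the limit; together with the uniform one it upgrades pointwise
  -- convergence of derivatives at `y` to uniform convergence near `y`, as differentiating the limit
  -- requires.
  have hG'L : ∀ y ∈ Metric.ball x R, ∀ z ∈ Metric.ball x R, ‖G' y - G' z‖ ≤ C * ‖y - z‖ := by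
    intro y hy z hz
    refine le_of_tendsto ((hG' y hy).sub (hG' z hz)).norm ?_
    filter_upwards [hL] with n hn using hn y hy z hz
  have hmain : ∀ y ∈ Metric.ball x R, HasFDerivAt G (G' y) y := by
    intro y hy
    have hyn : Metric.ball x R ∈ 𝓝 y := Metric.isOpen_ball.mem_nhds hy
    refine hasFDerivAt_of_tendstoUniformlyOnFilter (l := atTop) (f := g)
      (f' := fun n => fderiv ℝ (g n)) (g' := G') ?_ ?_ ?_
    · rw [Metric.tendstoUniformlyOnFilter_iff]
      intro ε hε
      have h1 : ∀ᶠ z in 𝓝 y, C * ‖z - y‖ < ε / 3 := by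
        have : Continuous fun z : V => C * ‖z - y‖ := by fun_prop
        exact (this.tendsto y).eventually (gt_mem_nhds (by simpa using by positivity))
      have h2 := Metric.tendsto_nhds.1 (hG' y hy) (ε / 3) (by positivity)
      filter_upwards [(hL.and h2).prod_mk (h1.and hyn)] with q ⟨⟨q1, q2⟩, q3, q4⟩
      have b1 := hG'L q.2 q4 y hy
      have b2 := q1 q.2 q4 y hy
      rw [← dist_eq_norm] at b1 b2
      rw [dist_comm] at b2 q2
      have := dist_triangle4 (G' q.2) (G' y) (fderiv ℝ (g q.1) y) (fderiv ℝ (g q.1) q.2)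
      linarith
    · filter_upwards [hg.prod_mk hyn] with q ⟨q1, q2⟩
      exact (q1 _ q2).hasFDerivAt
    · filter_upwards [hyn] with z hz using hlim z hz
  intro y hy
  refine ⟨(hmain y hy).differentiableAt, ?_⟩
  rw [(hmain y hy).fderiv]
  exact hG' y hy

/-- Functions that are eventually bounded at each point of a ball and have equi-Lipschitz second
derivatives there have eventually bounded second derivatives at the centre. -/
theorem eventually_norm_fderiv_fderiv_le [FiniteDimensional ℝ V] {g : ℕ → V → ℝ} {x : V} {R C : ℝ}
    (hR : 0 < R)
    (hg : ∀ᶠ n in atTop, ∀ y ∈ Metric.ball x R, DifferentiableAt ℝ (g n) y)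
    (hg2 : ∀ᶠ n in atTop, ∀ y ∈ Metric.ball x R, DifferentiableAt ℝ (fderiv ℝ (g n)) y)
    (hsymm : ∀ᶠ n in atTop, IsSymmSndFDerivAt ℝ (g n) x)
    (hL : ∀ᶠ n in atTop, ∀ y ∈ Metric.ball x R, ∀ z ∈ Metric.ball x R,
      ‖fderiv ℝ (fderiv ℝ (g n)) y - fderiv ℝ (fderiv ℝ (g n)) z‖ ≤ C * ‖y - z‖)
    (hbd : ∀ y ∈ Metric.ball x R, ∃ M, ∀ᶠ n in atTop, |g n y| ≤ M) :
    ∃ M, ∀ᶠ n in atTop, ‖fderiv ℝ (fderiv ℝ (g n)) x‖ ≤ M := by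
  have hxm := Metric.mem_ball_self (x := x) hR
  have hmem : ∀ w : V, ‖w‖ < R → x + w ∈ Metric.ball x R := fun w hw => by simpa using hw
  have hT : ∀ᶠ n in atTop, ∀ v, ‖v‖ < R →
      |g n (x + v) - g n x - fderiv ℝ (g n) x v
        - 1 / 2 * fderiv ℝ (fderiv ℝ (g n)) x v v| ≤ |C| * R * ‖v‖ ^ 2 := by
    filter_upwards [hg, hg2, hL] with n h1 h2 h3 v hv
    refine abs_taylor_two_le (r := R) (by positivity) (fun w hw => h1 _ (hmem w hw))
      (fun w hw => ?_) hv
    have := (convex_ball x R).norm_image_sub_le_of_norm_hasFDerivWithin_le'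
      (f := fderiv ℝ (g n)) (f' := fderiv ℝ (fderiv ℝ (g n))) (φ := fderiv ℝ (fderiv ℝ (g n)) x)
      (C := |C| * R) (fun z hz => (h2 z hz).hasFDerivAt.hasFDerivWithinAt)
      (fun z hz => (h3 z hz x hxm).trans (by
        have : ‖z - x‖ ≤ R := (mem_ball_iff_norm.1 hz).le
        exact mul_le_mul (le_abs_self C) this (norm_nonneg _) (abs_nonneg _)))
      hxm (hmem w hw)
    simpa using this
  have hdiag : ∀ v, ‖v‖ < R → ∃ M, ∀ᶠ n in atTop, |fderiv ℝ (fderiv ℝ (g n)) x v v| ≤ M := by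
    intro v hv
    obtain ⟨M₀, h0⟩ := hbd x hxm
    obtain ⟨M₁, h1⟩ := hbd _ (hmem v hv)
    obtain ⟨M₂, h2⟩ := hbd _ (hmem (-v) (by simpa using hv))
    refine ⟨M₁ + M₂ + 2 * M₀ + 2 * (|C| * R * ‖v‖ ^ 2), ?_⟩
    filter_upwards [hT, h0, h1, h2] with n hn h0 h1 h2
    -- Adding the expansions at `v` and `-v` cancels the gradient, on which there is no bound yet,
    -- and leaves the second derivative controlled by three values of `g n`.
    have t1 := hn v hv
    have t2 := hn (-v) (by simpa using hv)
    simp only [map_neg, norm_neg, neg_apply, neg_neg] at t2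
    rw [abs_le] at *
    constructor <;> linarith
  have hdiag' : ∀ v, ∃ M, ∀ᶠ n in atTop, |fderiv ℝ (fderiv ℝ (g n)) x v v| ≤ M := by
    intro v
    set s : ℝ := R / (2 * (‖v‖ + 1)) with hs
    have hs0 : 0 < s := by positivity
    obtain ⟨M, hM⟩ := hdiag (s • v) (by
      rw [norm_smul, Real.norm_of_nonneg hs0.le, hs, div_mul_eq_mul_div, div_lt_iff₀ (by positivity)]
      nlinarith [norm_nonneg v])
    refine ⟨M / s ^ 2, ?_⟩
    filter_upwards [hM] with n hn
    rw [le_div_iff₀ (by positivity)]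
    simp only [map_smul, smul_apply, smul_eq_mul, abs_mul,
      abs_of_pos hs0] at hn
    linarith
  -- Polarization: by symmetry, the values on the diagonal at `u + v` and `u - v` differ by four
  -- times the value at `(u, v)`.
  refine eventually_norm_clm_le_of_apply fun u => eventually_norm_clm_le_of_apply fun v => ?_
  obtain ⟨M₁, h1⟩ := hdiag' (u + v)
  obtain ⟨M₂, h2⟩ := hdiag' (u - v)
  refine ⟨M₁ + M₂, ?_⟩
  filter_upwards [h1, h2, hsymm] with n h1 h2 hs
  have := hs u v
  simp only [map_add, map_sub, add_apply, sub_apply] at h1 h2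
  rw [Real.norm_eq_abs]
  rw [abs_le] at *
  constructor <;> linarith

/-- Local convergence, with two derivatives, of a pointwise convergent sequence of functions with
bounded third derivatives. -/
theorem tendsto_fderiv_of_bounded_third [FiniteDimensional ℝ V] {g : ℕ → V → ℝ} {G : V → ℝ}
    {E : Set V} {C : ℝ} (hE : IsOpen E) {x : V} (hx : x ∈ E)
    (hg : ∀ᶠ n in atTop, ContDiffOn ℝ 3 (g n) E)
    (hb : ∀ᶠ n in atTop, ∀ y ∈ E, ‖fderiv ℝ (fderiv ℝ (fderiv ℝ (g n))) y‖ ≤ C)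
    (hlim : ∀ y ∈ E, Tendsto (fun n => g n y) atTop (𝓝 (G y))) :
    Tendsto (fun q : ℕ × V => g q.1 q.2) (atTop ×ˢ 𝓝 x) (𝓝 (G x)) ∧
    Tendsto (fun q : ℕ × V => fderiv ℝ (fderiv ℝ (g q.1)) q.2) (atTop ×ˢ 𝓝 x)
      (𝓝 (fderiv ℝ (fderiv ℝ G) x)) ∧
    (∀ᶠ y in 𝓝 x, DifferentiableAt ℝ G y) ∧ DifferentiableAt ℝ (fderiv ℝ G) x := by
  obtain ⟨R, hR, hball⟩ := Metric.isOpen_iff.1 hE x hx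
  have hxm := Metric.mem_ball_self (x := x) hR
  have hC3 : ∀ᶠ n in atTop, ∀ y ∈ Metric.ball x R, ContDiffAt ℝ 3 (g n) y := by
    filter_upwards [hg] with n hn y hy using hn.contDiffAt (hE.mem_nhds (hball hy))
  have hd1 : ∀ᶠ n in atTop, ∀ y ∈ Metric.ball x R, DifferentiableAt ℝ (g n) y := by
    filter_upwards [hC3] with n hn y hy using (hn y hy).differentiableAt (by norm_num)
  have hC2 : ∀ᶠ n in atTop, ∀ y ∈ Metric.ball x R, ContDiffAt ℝ 2 (fderiv ℝ (g n)) y := by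
    filter_upwards [hC3] with n hn y hy using (hn y hy).fderiv_right (by norm_num)
  have hd2 : ∀ᶠ n in atTop, ∀ y ∈ Metric.ball x R, DifferentiableAt ℝ (fderiv ℝ (g n)) y := by
    filter_upwards [hC2] with n hn y hy using (hn y hy).differentiableAt (by norm_num)
  have hd3 : ∀ᶠ n in atTop, ∀ y ∈ Metric.ball x R,
      DifferentiableAt ℝ (fderiv ℝ (fderiv ℝ (g n))) y := by
    filter_upwards [hC2] with n hn y hy
    exact ((hn y hy).fderiv_right (m := 1) (by norm_num)).differentiableAt (by norm_num)
  -- Bounds descend in order: `f_n''` is equi-Lipschitz, hence bounded on the ball once bounded at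
  -- `x`, hence `f_n'` is equi-Lipschitz, and later `f_n` as well.
  have hL2 : ∀ᶠ n in atTop, ∀ y ∈ Metric.ball x R, ∀ z ∈ Metric.ball x R,
      ‖fderiv ℝ (fderiv ℝ (g n)) y - fderiv ℝ (fderiv ℝ (g n)) z‖ ≤ C * ‖y - z‖ := by
    filter_upwards [hd3, hb] with n hn hbn y hy z hz
    exact (convex_ball x R).norm_image_sub_le_of_norm_fderiv_le hn
      (fun w hw => hbn w (hball hw)) hz hy
  have hlim' : ∀ y ∈ Metric.ball x R, Tendsto (fun n => g n y) atTop (𝓝 (G y)) :=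
    fun y hy => hlim y (hball hy)
  obtain ⟨M, hM⟩ := eventually_norm_fderiv_fderiv_le hR hd1 hd2
    (by filter_upwards [hC3] with n hn using (hn x hxm).isSymmSndFDerivAt (by
      rw [minSmoothness_of_isRCLikeNormedField]; norm_num))
    hL2 (fun y hy => by
      refine ⟨|G y| + 1, ?_⟩
      exact (hlim' y hy).abs.eventually_le_const (by linarith))
  have hB2 : ∀ᶠ n in atTop, ∀ y ∈ Metric.ball x R,
      ‖fderiv ℝ (fderiv ℝ (g n)) y‖ ≤ M + |C| * R := by
    filter_upwards [hM, hL2] with n h1 h2 y hy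
    have h3 := norm_le_norm_add_norm_sub' (fderiv ℝ (fderiv ℝ (g n)) y)
      (fderiv ℝ (fderiv ℝ (g n)) x)
    have h4 : C * ‖y - x‖ ≤ |C| * R :=
      mul_le_mul (le_abs_self C) (mem_ball_iff_norm.1 hy).le (norm_nonneg _) (abs_nonneg _)
    linarith [h2 y hy x hxm]
  have hL1 : ∀ᶠ n in atTop, ∀ y ∈ Metric.ball x R, ∀ z ∈ Metric.ball x R,
      ‖fderiv ℝ (g n) y - fderiv ℝ (g n) z‖ ≤ (M + |C| * R) * ‖y - z‖ := by
    filter_upwards [hd2, hB2] with n hn hbn y hy z hz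
    exact (convex_ball x R).norm_image_sub_le_of_norm_fderiv_le hn hbn hz hy
  have hD1 := differentiableAt_and_tendsto_fderiv_of_equiLipschitz hd1 hL1 hlim'
  have hD2 := differentiableAt_and_tendsto_fderiv_of_equiLipschitz hd2 hL2
    (fun y hy => (hD1 y hy).2)
  have hL0 : ∀ᶠ n in atTop, ∀ y ∈ Metric.ball x R, ∀ z ∈ Metric.ball x R,
      ‖g n y - g n z‖ ≤ (‖fderiv ℝ G x‖ + 1 + |M + |C| * R| * R) * ‖y - z‖ := by
    have h5 := (hD1 x hxm).2.norm.eventually_le_const (lt_add_one ‖fderiv ℝ G x‖)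
    filter_upwards [hd1, hL1, h5] with n hn h1 h2 y hy z hz
    refine (convex_ball x R).norm_image_sub_le_of_norm_fderiv_le hn (fun w hw => ?_) hz hy
    have h3 := norm_le_norm_add_norm_sub' (fderiv ℝ (g n) w) (fderiv ℝ (g n) x)
    have h4 : (M + |C| * R) * ‖w - x‖ ≤ |M + |C| * R| * R :=
      mul_le_mul (le_abs_self _) (mem_ball_iff_norm.1 hw).le (norm_nonneg _) (abs_nonneg _)
    linarith [h1 w hw x hxm]
  refine ⟨tendsto_prod_of_equiLipschitz hR hL0 (hlim' x hxm),
    tendsto_prod_of_equiLipschitz (h := fun n => fderiv ℝ (fderiv ℝ (g n))) hR hL2 (hD2 x hxm).2,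
    ?_, (hD2 x hxm).1⟩
  filter_upwards [Metric.ball_mem_nhds x hR] with y hy using (hD1 y hy).1

end Regularity

/-- The third derivative, as an iterated Fréchet derivative, is controlled by `tensorNorm`. -/
theorem norm_fderiv_third_le {D : ℕ} (g : Euc D → ℝ) (x : Euc D) :
    ‖fderiv ℝ (fderiv ℝ (fderiv ℝ g)) x‖ ≤ D ^ 3 * tensorNorm (thirdDeriv g x) := by
  have h0 : ‖fderiv ℝ (fderiv ℝ (fderiv ℝ g)) x‖ = ‖iteratedFDeriv ℝ 3 g x‖ := by
    rw [← norm_iteratedFDeriv_one, norm_iteratedFDeriv_fderiv, norm_iteratedFDeriv_fderiv]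
  have hent : ∀ i j k, |thirdDeriv g x i j k| ≤ tensorNorm (thirdDeriv g x) := by
    intro i j k
    refine Real.abs_le_sqrt ?_
    calc thirdDeriv g x i j k ^ 2 ≤ ∑ k, thirdDeriv g x i j k ^ 2 :=
          Finset.single_le_sum (f := fun k => thirdDeriv g x i j k ^ 2)
            (fun _ _ => sq_nonneg _) (Finset.mem_univ k)
      _ ≤ ∑ j, ∑ k, thirdDeriv g x i j k ^ 2 :=
          Finset.single_le_sum (f := fun j => ∑ k, thirdDeriv g x i j k ^ 2)
            (fun _ _ => Finset.sum_nonneg fun _ _ => sq_nonneg _) (Finset.mem_univ j)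
      _ ≤ _ := Finset.single_le_sum (f := fun i => ∑ j, ∑ k, thirdDeriv g x i j k ^ 2)
            (fun _ _ => Finset.sum_nonneg fun _ _ => Finset.sum_nonneg fun _ _ => sq_nonneg _)
            (Finset.mem_univ i)
  have hT : 0 ≤ tensorNorm (thirdDeriv g x) := Real.sqrt_nonneg _
  rw [h0]
  refine ContinuousMultilinearMap.opNorm_le_bound (by positivity) fun m => ?_
  -- Expanding the three arguments in the standard basis gives `D ^ 3` terms, each at most the
  -- Frobenius norm times `∏ a, ‖m a‖`.
  have hm : m = fun a => ∑ i : Fin D, m a i • (e i : Euc D) := by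
    funext a
    ext j
    simp [e, Pi.single_apply]
  conv_lhs => rw [hm]
  rw [ContinuousMultilinearMap.map_sum]
  refine (norm_sum_le _ _).trans ?_
  have hterm : ∀ r : Fin 3 → Fin D, ‖iteratedFDeriv ℝ 3 g x fun a => m a (r a) • e (r a)‖
      ≤ tensorNorm (thirdDeriv g x) * ∏ a, ‖m a‖ := by
    intro r
    rw [ContinuousMultilinearMap.map_smul_univ, norm_smul, norm_prod, mul_comm]
    have h1 : (fun a => (e (r a) : Euc D)) = ![e (r 0), e (r 1), e (r 2)] := by
      funext a; fin_cases a <;> rfl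
    rw [h1]
    refine mul_le_mul (hent _ _ _) ?_ (by positivity) hT
    exact Finset.prod_le_prod (fun _ _ => norm_nonneg _) fun a _ => PiLp.norm_apply_le (m a) (r a)
  refine (Finset.sum_le_sum fun r _ => hterm r).trans (le_of_eq ?_)
  simp
  ring

/-! ### Separation, critical points and quadratic expansions -/

/-- A strict lower bound of the limit on a compact set holds eventually, uniformly with a margin. -/
theorem exists_margin_of_isCompact {V : Type*} [TopologicalSpace V] {g : ℕ → V → ℝ} {G : V → ℝ}
    {K : Set V} (hK : IsCompact K)
    (h : ∀ x ∈ K, Tendsto (fun q : ℕ × V => g q.1 q.2) (atTop ×ˢ 𝓝 x) (𝓝 (G x)))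
    {a : ℝ} (ha : ∀ x ∈ K, a < G x) :
    ∃ η > 0, ∀ᶠ n in atTop, ∀ y ∈ K, a + η ≤ g n y := by
  refine hK.induction_on (p := fun s => ∃ η > 0, ∀ᶠ n in atTop, ∀ y ∈ s, a + η ≤ g n y)
    ⟨1, one_pos, by simp⟩ ?_ ?_ ?_
  · rintro s t hst ⟨η, hη, ht⟩
    exact ⟨η, hη, ht.mono fun n hn y hy => hn y (hst hy)⟩
  · rintro s t ⟨η₁, h₁, hs⟩ ⟨η₂, h₂, ht⟩
    refine ⟨min η₁ η₂, lt_min h₁ h₂, ?_⟩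
    filter_upwards [hs, ht] with n hs ht y hy
    rcases hy with hy | hy
    · linarith [hs y hy, min_le_left η₁ η₂]
    · linarith [ht y hy, min_le_right η₁ η₂]
  · intro x hx
    have hax := ha x hx
    have h1 := (h x hx).eventually (lt_mem_nhds (show (a + G x) / 2 < G x by linarith))
    obtain ⟨pa, hpa, pb, hpb, hab⟩ := eventually_prod_iff.1 h1
    refine ⟨{y | pb y}, mem_nhdsWithin_of_mem_nhds hpb, (G x - a) / 2, by linarith, ?_⟩
    filter_upwards [hpa] with n hn y hy
    have := hab hn hy
    simp only at this
    linarith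

/-- The separation condition separates `f_n` from `f(θ₀)` off every ball about `θ₀`. -/
theorem SeparationCond.exists_margin {D : ℕ} {Θ E : Set (Euc D)} {θ₀ : Euc D}
    {fn : ℕ → Euc D → ℝ} {f : Euc D → ℝ} (hsep : SeparationCond Θ E θ₀ fn f)
    (h : ∀ x ∈ E, Tendsto (fun q : ℕ × Euc D => fn q.1 q.2) (atTop ×ˢ 𝓝 x) (𝓝 (f x)))
    {r : ℝ} (hr : 0 < r) :
    ∃ η > 0, ∀ᶠ n in atTop, ∀ θ ∈ Θ, r ≤ ‖θ - θ₀‖ → f θ₀ + η ≤ fn n θ := by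
  obtain ⟨K, hK, hKE, -, hKf, hlim⟩ := hsep
  obtain ⟨η₁, hη₁, h1⟩ := exists_margin_of_isCompact (hK.diff (Metric.isOpen_ball (x := θ₀) (ε := r)))
    (fun x hx => h x (hKE hx.1)) (a := f θ₀) (fun x hx => hKf x ⟨hx.1, fun hx0 => hx.2 (by
      rw [Set.mem_singleton_iff.1 hx0]; exact Metric.mem_ball_self hr)⟩)
  -- The lower limit may be infinite, for instance when `Θ \ K` is empty, so a real level strictly
  -- below it supplies the margin off `K`.
  obtain ⟨b, hb1, hb2⟩ := EReal.lt_iff_exists_real_btwn.1 hlim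
  have hb1' : f θ₀ < b := EReal.coe_lt_coe_iff.1 hb1
  refine ⟨min η₁ (b - f θ₀), lt_min hη₁ (by linarith), ?_⟩
  filter_upwards [h1, eventually_lt_of_lt_liminf hb2] with n h1 h2 θ hθ hrθ
  by_cases hθK : θ ∈ K
  · have := h1 θ ⟨hθK, fun hm => by rw [mem_ball_iff_norm] at hm; linarith⟩
    linarith [min_le_left η₁ (b - f θ₀)]
  · have h3 : (b : EReal) < fn n θ := h2.trans_le (iInf₂_le θ ⟨hθ, hθK⟩)
    have h4 : b < fn n θ := EReal.coe_lt_coe_iff.1 h3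
    linarith [min_le_right η₁ (b - f θ₀)]

/-- A positive quadratic form on a finite-dimensional space is coercive. -/
theorem exists_coercive {V : Type*} [NormedAddCommGroup V] [NormedSpace ℝ V]
    [FiniteDimensional ℝ V] (S : V →L[ℝ] V →L[ℝ] ℝ) (hS : ∀ v, v ≠ 0 → 0 < S v v) :
    ∃ c > 0, ∀ v, c * ‖v‖ ^ 2 ≤ S v v := by
  have hcont : Continuous fun v => S v v := by fun_prop
  -- The unit sphere is empty when the space is trivial, which covers `D = 0`; any constant then
  -- serves.
  rcases (Metric.sphere (0 : V) 1).eq_empty_or_nonempty with he | hne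
  · refine ⟨1, one_pos, fun v => ?_⟩
    by_cases hv : v = 0
    · simp [hv]
    · have : ‖v‖⁻¹ • v ∈ Metric.sphere (0 : V) 1 := by simp [norm_smul, hv]
      rw [he] at this
      exact this.elim
  · have : ProperSpace V := FiniteDimensional.proper ℝ V
    obtain ⟨u, hu, hmin⟩ := (isCompact_sphere (0 : V) 1).exists_isMinOn hne hcont.continuousOn
    refine ⟨S u u, hS u (by rintro rfl; simp at hu), fun v => ?_⟩
    by_cases hv : v = 0
    · simp [hv]
    · have hm : ‖v‖⁻¹ • v ∈ Metric.sphere (0 : V) 1 := by simp [norm_smul, hv]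
      have hv' : 0 < ‖v‖ := norm_pos_iff.2 hv
      have h1 : S u u ≤ S (‖v‖⁻¹ • v) (‖v‖⁻¹ • v) := hmin hm
      simp only [map_smul, smul_apply, smul_eq_mul] at h1
      rw [← mul_assoc, ← mul_inv, inv_mul_eq_div, le_div_iff₀ (by positivity)] at h1
      linarith [sq ‖v‖]

/-- A critical point with positive second derivative is an isolated strict local minimum. -/
theorem exists_strict_min {V : Type*} [NormedAddCommGroup V] [NormedSpace ℝ V]
    [FiniteDimensional ℝ V] {f : V → ℝ} {x : V} (hf : ∀ᶠ y in 𝓝 x, DifferentiableAt ℝ f y)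
    (hf2 : DifferentiableAt ℝ (fderiv ℝ f) x) (h0 : fderiv ℝ f x = 0)
    (hpos : ∀ v, v ≠ 0 → 0 < fderiv ℝ (fderiv ℝ f) x v v) :
    ∃ r > 0, ∀ y, y ≠ x → ‖y - x‖ < r → f x < f y := by
  obtain ⟨c, hc, hcS⟩ := exists_coercive _ hpos
  -- A Taylor error of `c / 4` is beaten by the quadratic term, which is at least `c / 2` times `‖v‖
  -- ^ 2`.
  have h1 := hf2.hasFDerivAt.isLittleO.def (show 0 < c / 4 by positivity)
  obtain ⟨r, hr, hrb⟩ := Metric.eventually_nhds_iff.1 (hf.and h1)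
  have hrb' : ∀ w, ‖w‖ < r → dist (x + w) x < r := fun w hw => by simpa using hw
  refine ⟨r, hr, fun y hy hyr => ?_⟩
  have h2 := abs_taylor_two_le (f := f) (x := x) (v := y - x) (r := r) (K := c / 4)
    (S := fderiv ℝ (fderiv ℝ f) x) (by positivity) (fun w hw => (hrb (hrb' w hw)).1)
    (fun w hw => by simpa using (hrb (hrb' w hw)).2) hyr
  have hn : 0 < ‖y - x‖ := norm_pos_iff.2 (sub_ne_zero.2 hy)
  simp only [h0, add_sub_cancel, zero_apply, sub_zero] at h2
  rw [abs_le] at h2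
  nlinarith [hcS (y - x), h2.1, mul_pos hc (pow_pos hn 2)]

/-- Minimisers over a fixed ball converge to the separated point and are local minimisers. -/
theorem exists_tendsto_isLocalMin {V : Type*} [NormedAddCommGroup V] [ProperSpace V] {E : Set V}
    {x : V} {a : ℝ} {g : ℕ → V → ℝ} (hE : IsOpen E) (hx : x ∈ E)
    (hc : ∀ᶠ n in atTop, ContinuousOn (g n) E) (hlim : Tendsto (fun n => g n x) atTop (𝓝 a))
    (hsep : ∀ r > 0, ∃ η > 0, ∀ᶠ n in atTop, ∀ y ∈ E, r ≤ ‖y - x‖ → a + η ≤ g n y) :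
    ∃ xs : ℕ → V, (∀ n, xs n ∈ E) ∧ Tendsto xs atTop (𝓝 x) ∧
      ∀ᶠ n in atTop, IsLocalMin (g n) (xs n) := by
  obtain ⟨R, hR, hball⟩ := Metric.nhds_basis_closedBall.mem_iff.1 (hE.mem_nhds hx)
  have hxR : x ∈ Metric.closedBall x R := Metric.mem_closedBall_self hR.le
  have hex : ∀ n, ∃ y ∈ Metric.closedBall x R, ContinuousOn (g n) E →
      IsMinOn (g n) (Metric.closedBall x R) y := by
    intro n
    by_cases h : ContinuousOn (g n) E
    · obtain ⟨y, hy, hm⟩ := (isCompact_closedBall x R).exists_isMinOn ⟨x, hxR⟩ (h.mono hball)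
      exact ⟨y, hy, fun _ => hm⟩
    · exact ⟨x, hxR, fun h' => absurd h' h⟩
  choose xs hxs hmin using hex
  have ht : Tendsto xs atTop (𝓝 x) := by
    rw [Metric.tendsto_nhds]
    intro r hr
    obtain ⟨η, hη, hs⟩ := hsep r hr
    filter_upwards [hs, hc, hlim.eventually (gt_mem_nhds (show a < a + η by linarith))]
      with n h1 h2 h3
    by_contra hcon
    rw [not_lt, dist_eq_norm] at hcon
    have h4 : g n (xs n) ≤ g n x := hmin n h2 hxR
    linarith [h1 (xs n) (hball (hxs n)) hcon]
  refine ⟨xs, fun n => hball (hxs n), ht, ?_⟩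
  filter_upwards [hc, ht.eventually (Metric.ball_mem_nhds x hR)] with n h1 h2
  exact (hmin n h1).isLocalMin
    (mem_of_superset (Metric.isOpen_ball.mem_nhds h2) Metric.ball_subset_closedBall)

/-- Uniform quadratic expansion about critical points that converge to `x`. -/
theorem exists_quadratic_expansion {V : Type*} [NormedAddCommGroup V] [NormedSpace ℝ V]
    {g : ℕ → V → ℝ} {E : Set V} {x : V} {S : V →L[ℝ] V →L[ℝ] ℝ} {xs : ℕ → V}
    (hE : IsOpen E) (hx : x ∈ E) (hg : ∀ᶠ n in atTop, ContDiffOn ℝ 3 (g n) E)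
    (hS : Tendsto (fun q : ℕ × V => fderiv ℝ (fderiv ℝ (g q.1)) q.2) (atTop ×ˢ 𝓝 x) (𝓝 S))
    (hxs : Tendsto xs atTop (𝓝 x)) (hcrit : ∀ᶠ n in atTop, fderiv ℝ (g n) (xs n) = 0)
    {δ : ℝ} (hδ : 0 < δ) :
    ∃ r > 0, ∀ᶠ n in atTop, ∀ v, ‖v‖ < r →
      |g n (xs n + v) - g n (xs n) - 1 / 2 * S v v| ≤ δ * ‖v‖ ^ 2 := by
  have h1 : ∀ᶠ q : ℕ × V in atTop ×ˢ 𝓝 x, ‖fderiv ℝ (fderiv ℝ (g q.1)) q.2 - S‖ ≤ δ := by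
    filter_upwards [Metric.tendsto_nhds.1 hS δ hδ] with q hq
    rw [dist_eq_norm] at hq
    exact hq.le
  obtain ⟨pa, hpa, pb, hpb, hab⟩ := eventually_prod_iff.1 h1
  obtain ⟨R, hR, hball⟩ := Metric.mem_nhds_iff.1 (inter_mem hpb (hE.mem_nhds hx))
  refine ⟨R / 2, by positivity, ?_⟩
  filter_upwards [hg, hcrit, hpa, hxs.eventually (Metric.ball_mem_nhds x (half_pos hR))]
    with n h2 h3 h4 h5 v hv
  have hsub : Metric.ball (xs n) (R / 2) ⊆ Metric.ball x R := by
    refine Metric.ball_subset_ball' ?_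
    linarith
  have hC : ∀ y ∈ Metric.ball (xs n) (R / 2), ContDiffAt ℝ 3 (g n) y := fun y hy =>
    h2.contDiffAt (hE.mem_nhds (hball (hsub hy)).2)
  have hmem : ∀ w : V, ‖w‖ < R / 2 → xs n + w ∈ Metric.ball (xs n) (R / 2) := fun w hw => by
    simpa using hw
  -- The expansion is centred at the critical point, so no linear term remains; `S` stays fixed
  -- because `‖g n'' - S‖ ≤ δ` on the whole convex ball.
  have := abs_taylor_two_le (f := g n) (x := xs n) (v := v) (r := R / 2) (K := δ) (S := S) hδ.le
    (fun w hw => (hC _ (hmem w hw)).differentiableAt (by norm_num))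
    (fun w hw => by
      have := (convex_ball (xs n) (R / 2)).norm_image_sub_le_of_norm_hasFDerivWithin_le'
        (f := fderiv ℝ (g n)) (f' := fderiv ℝ (fderiv ℝ (g n))) (φ := S) (C := δ)
        (fun z hz => (((hC z hz).fderiv_right (m := 2) (by norm_num)).differentiableAt
          (by norm_num)).hasFDerivAt.hasFDerivWithinAt)
        (fun z hz => hab h4 (hball (hsub hz)).1)
        (Metric.mem_ball_self (half_pos hR)) (hmem w hw)
      simpa using this) hv
  simpa [h3] using this

/-- The quadratic form of the Hessian matrix is the second derivative. -/
theorem hessian_quadForm {D : ℕ} (f : Euc D → ℝ) (x v : Euc D) :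
    v.ofLp ⬝ᵥ (hessian f x).mulVec v.ofLp = fderiv ℝ (fderiv ℝ f) x v v := by
  have hv : v = ∑ i : Fin D, v i • (e i : Euc D) := by
    ext j
    simp [e, Pi.single_apply]
  conv_rhs => rw [hv]
  simp only [map_sum, map_smul, sum_apply, smul_apply, smul_eq_mul, dotProduct,
    Matrix.mulVec, hessian, Matrix.of_apply, iteratedFDeriv_two_apply]
  simp only [Finset.mul_sum]
  rw [Finset.sum_comm]
  refine Finset.sum_congr rfl fun i _ => Finset.sum_congr rfl fun j _ => ?_
  simp
  ring

/-- Convexity and a nondegenerate critical point imply separation. -/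
theorem ConvexCond.separationCond {D : ℕ} {Θ E : Set (Euc D)} {θ₀ : Euc D}
    {fn : ℕ → Euc D → ℝ} {f : Euc D → ℝ} (hconv : ConvexCond Θ θ₀ fn f) (hEΘ : E ⊆ Θ)
    (hEo : IsOpen E) (hθ₀ : θ₀ ∈ E)
    (h : ∀ x ∈ E, Tendsto (fun q : ℕ × Euc D => fn q.1 q.2) (atTop ×ˢ 𝓝 x) (𝓝 (f x)))
    (hlim : Tendsto (fun n => fn n θ₀) atTop (𝓝 (f θ₀)))
    (hd : ∀ᶠ y in 𝓝 θ₀, DifferentiableAt ℝ f y) (hd2 : DifferentiableAt ℝ (fderiv ℝ f) θ₀)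
    (hpos : ∀ v, v ≠ 0 → 0 < fderiv ℝ (fderiv ℝ f) θ₀ v v) :
    SeparationCond Θ E θ₀ fn f := by
  have h0 : fderiv ℝ f θ₀ = 0 := by
    have := hconv.2.hasFDerivAt.fderiv
    simpa using this
  obtain ⟨r, hr, hmin⟩ := exists_strict_min hd hd2 h0 hpos
  obtain ⟨R, hR, hball⟩ := Metric.nhds_basis_closedBall.mem_iff.1 (hEo.mem_nhds hθ₀)
  obtain ⟨ρ, hρ, hρr, hρR⟩ : ∃ ρ > 0, ρ < r ∧ ρ ≤ R :=
    ⟨min (r / 2) R, by positivity, (min_le_left _ _).trans_lt (half_lt_self hr), min_le_right _ _⟩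
  have hKE : Metric.closedBall θ₀ ρ ⊆ E := (Metric.closedBall_subset_closedBall hρR).trans hball
  refine ⟨Metric.closedBall θ₀ ρ, isCompact_closedBall _ _, hKE,
    mem_interior_iff_mem_nhds.2 (Metric.closedBall_mem_nhds _ hρ), fun θ hθ => ?_, ?_⟩
  · exact hmin θ hθ.2 ((mem_closedBall_iff_norm.1 hθ.1).trans_lt hρr)
  · have hS : Metric.sphere θ₀ ρ ⊆ Metric.closedBall θ₀ ρ := Metric.sphere_subset_closedBall
    obtain ⟨η, hη, hm⟩ := exists_margin_of_isCompact (isCompact_sphere θ₀ ρ)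
      (fun x hx => h x (hKE (hS hx))) (a := f θ₀) (fun x hx => by
        rw [mem_sphere_iff_norm] at hx
        refine hmin x ?_ (by linarith)
        rintro rfl
        simp at hx
        linarith)
    refine (EReal.coe_lt_coe_iff.2 (show f θ₀ < f θ₀ + η by linarith)).trans_le ?_
    refine le_liminf_of_le (by isBoundedDefault) ?_
    filter_upwards [hm, eventually_ge_atTop 1, hlim.eventually
      (gt_mem_nhds (show f θ₀ < f θ₀ + η by linarith))] with n hn hn1 hn0
    refine le_iInf₂ fun θ hθ => EReal.coe_le_coe_iff.2 ?_
    have hd : ρ < ‖θ - θ₀‖ := by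
      have := hθ.2
      rwa [mem_closedBall_iff_norm, not_le] at this
    have hd0 : 0 < ‖θ - θ₀‖ := hρ.trans hd
    -- The point at parameter `t` is where the segment from `θ₀` to `θ` crosses the sphere; it lies
    -- in `E ⊆ Θ`, so convexity applies although `Θ` need not be convex. The value there is at least
    -- `f θ₀ + η` and the value at `θ₀` is below it, which forces the value at `θ` up to `f θ₀ + η`.
    set t := ρ / ‖θ - θ₀‖ with ht
    have ht0 : 0 < t := by positivity
    have ht1 : t < 1 := (div_lt_one hd0).2 hd
    have hy : t • θ + (1 - t) • θ₀ ∈ Metric.sphere θ₀ ρ := by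
      rw [mem_sphere_iff_norm, show t • θ + (1 - t) • θ₀ - θ₀ = t • (θ - θ₀) by
        rw [smul_sub, sub_smul, one_smul]; abel, norm_smul, Real.norm_of_nonneg ht0.le, ht]
      field_simp
    have h1 := hconv.1 n hn1 θ hθ.1 θ₀ (hEΘ hθ₀) t ⟨ht0.le, ht1.le⟩ (hEΘ (hKE (hS hy)))
    have h2 := hn _ hy
    nlinarith

/-! ### Gaussian integrals -/

open scoped MatrixOrder in
/-- The Gaussian integral of a positive definite matrix. -/
theorem integral_exp_neg_half_quadForm {D : ℕ} {H : Matrix (Fin D) (Fin D) ℝ} (hH : H.PosDef) :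
    ∫ v : Euc D, Real.exp (-(1 / 2) * (v.ofLp ⬝ᵥ H.mulVec v.ofLp)) =
      (2 * Real.pi) ^ ((D : ℝ) / 2) / Real.sqrt H.det := by
  -- With `H = Bᵀ B` the form is `‖B v‖ ^ 2`, and the linear substitution `w = B v` has Jacobian
  -- `|det B| = √(det H)`.
  obtain ⟨B, hB⟩ := CStarAlgebra.nonneg_iff_eq_star_mul_self.1 hH.posSemidef.nonneg
  rw [Matrix.star_eq_conjTranspose] at hB
  have hdet : H.det = B.det ^ 2 := by
    rw [hB, Matrix.det_mul, Matrix.det_conjTranspose]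
    simp [sq]
  have hBdet : B.det ≠ 0 := by
    have := hH.det_pos
    rw [hdet] at this
    exact fun h => by simp [h] at this
  have hquad : ∀ v : Euc D, v.ofLp ⬝ᵥ H.mulVec v.ofLp = ‖Matrix.toEuclideanLin B v‖ ^ 2 := by
    intro v
    rw [EuclideanSpace.norm_sq_eq, hB, ← Matrix.mulVec_mulVec, Matrix.dotProduct_mulVec,
      Matrix.conjTranspose_eq_transpose_of_trivial, Matrix.vecMul_transpose]
    simp [dotProduct, Matrix.toLpLin_apply, sq]
  have hTdet : LinearMap.det (Matrix.toEuclideanLin B) = B.det :=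
    LinearMap.det_toLpLin 2 B
  have hmap := Measure.map_linearMap_addHaar_eq_smul_addHaar (volume : Measure (Euc D))
    (f := Matrix.toEuclideanLin B) (by rwa [hTdet])
  have hTc : Continuous (Matrix.toEuclideanLin B) := LinearMap.continuous_of_finiteDimensional _
  simp_rw [hquad]
  rw [← integral_map (f := fun w : Euc D => Real.exp (-(1 / 2) * ‖w‖ ^ 2)) hTc.aemeasurable
      (by fun_prop), hmap,
    integral_smul_measure, GaussianFourier.integral_rexp_neg_mul_sq_norm (by norm_num), hTdet,
    hdet, Real.sqrt_sq_eq_abs, ENNReal.toReal_ofReal (abs_nonneg _), finrank_euclideanSpace_fin,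
    abs_inv, smul_eq_mul, show Real.pi / (1 / 2) = 2 * Real.pi by ring]
  ring

/-- Gaussian functions of the norm are integrable. -/
theorem integrable_exp_neg_mul_sq_norm {D : ℕ} {b : ℝ} (hb : 0 < b) :
    Integrable fun v : Euc D => Real.exp (-b * ‖v‖ ^ 2) := by
  -- The Bochner integral of a non-integrable function is `0`, whereas the known value is positive.
  by_contra h
  have h1 := GaussianFourier.integral_rexp_neg_mul_sq_norm (V := Euc D) hb
  rw [integral_undef h] at h1
  have h2 : 0 < (Real.pi / b) ^ ((Module.finrank ℝ (Euc D) : ℝ) / 2) :=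
    Real.rpow_pos_of_pos (by positivity) _
  exact h2.ne h1

/-! ### Rescaled weights and the Laplace setting -/

/-- The unnormalized posterior density, extended by zero. -/
def weight {D : ℕ} (Θ : Set (Euc D)) (p g : Euc D → ℝ) (n : ℕ) : Euc D → ℝ :=
  Θ.indicator fun θ => Real.exp (-(n : ℝ) * g θ) * p θ

/-- The unnormalized posterior density in the coordinate `√n (θ - c)`, divided by its exponential
factor at `c`. -/
def rescaledWeight {D : ℕ} (Θ : Set (Euc D)) (p g : Euc D → ℝ) (n : ℕ) (c x : Euc D) : ℝ :=
  Real.exp (n * g c) * weight Θ p g n (c + (Real.sqrt n)⁻¹ • x)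

theorem measurable_indicator_of_restrict {D : ℕ} {Θ : Set (Euc D)} {g : Euc D → ℝ}
    (hΘ : MeasurableSet Θ) (hg : Measurable fun θ : Θ => g θ) : Measurable (Θ.indicator g) := by
  refine measurable_of_restrict_of_restrict_compl hΘ ?_ ?_
  · convert hg using 1
    funext x
    simp
  · convert measurable_const (a := (0 : ℝ)) using 1
    funext x
    exact Set.indicator_of_notMem x.2 g

theorem measurable_weight {D : ℕ} {Θ : Set (Euc D)} {p g : Euc D → ℝ} {n : ℕ}
    (hΘ : MeasurableSet Θ) (hp : Measurable fun θ : Θ => p θ) (hg : Measurable fun θ : Θ => g θ) :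
    Measurable (weight Θ p g n) :=
  measurable_indicator_of_restrict hΘ ((hg.const_mul _).exp.mul hp)

theorem measurable_rescaledWeight {D : ℕ} {Θ : Set (Euc D)} {p g : Euc D → ℝ} {n : ℕ} {c : Euc D}
    (hΘ : MeasurableSet Θ) (hp : Measurable fun θ : Θ => p θ) (hg : Measurable fun θ : Θ => g θ) :
    Measurable (rescaledWeight Θ p g n c) :=
  ((measurable_weight hΘ hp hg).comp (by fun_prop)).const_mul _

theorem weight_nonneg {D : ℕ} {Θ : Set (Euc D)} {p : Euc D → ℝ} (hp : ∀ θ ∈ Θ, 0 ≤ p θ)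
    (g : Euc D → ℝ) (n : ℕ) (θ : Euc D) : 0 ≤ weight Θ p g n θ :=
  Set.indicator_nonneg (fun θ hθ => mul_nonneg (Real.exp_pos _).le (hp θ hθ)) θ

theorem rescaledWeight_nonneg {D : ℕ} {Θ : Set (Euc D)} {p : Euc D → ℝ} (hp : ∀ θ ∈ Θ, 0 ≤ p θ)
    (g : Euc D → ℝ) (n : ℕ) (c x : Euc D) : 0 ≤ rescaledWeight Θ p g n c x :=
  mul_nonneg (Real.exp_pos _).le (weight_nonneg hp _ _ _)

/-- Affine change of variables at scale `1 / √n`. -/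
theorem integral_comp_rescale {D n : ℕ} (F : Euc D → ℝ) (c : Euc D) :
    ∫ x, F (c + (Real.sqrt n)⁻¹ • x) = Real.sqrt n ^ D * ∫ θ, F θ := by
  rw [Measure.integral_comp_inv_smul volume (fun y => F (c + y)), integral_add_left_eq_self,
    finrank_euclideanSpace_fin, abs_of_nonneg (by positivity), smul_eq_mul]

theorem integrable_comp_rescale_iff {D n : ℕ} (hn : 0 < n) (F : Euc D → ℝ) (c : Euc D) :
    Integrable (fun x => F (c + (Real.sqrt n)⁻¹ • x)) ↔ Integrable F := by
  have h : (Real.sqrt n)⁻¹ ≠ 0 := by positivity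
  rw [integrable_comp_smul_iff volume (fun y => F (c + y)) h]
  exact ⟨fun h => by simpa using h.comp_add_left (-c), fun h => h.comp_add_left c⟩

theorem IsProbDensityOn.integrable_indicator {D : ℕ} {Θ : Set (Euc D)} {p : Euc D → ℝ}
    (hp : IsProbDensityOn Θ p) (hΘ : MeasurableSet Θ) :
    Integrable (Θ.indicator p) ∧ ∫ θ, Θ.indicator p θ = 1 := by
  have hm := measurable_indicator_of_restrict hΘ hp.measurable
  have h0 : ∀ θ, 0 ≤ Θ.indicator p θ := Set.indicator_nonneg hp.nonneg
  have h1 : ∫⁻ θ, ENNReal.ofReal (Θ.indicator p θ) = 1 := by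
    rw [← hp.lintegral_eq_one, ← lintegral_indicator hΘ]
    refine lintegral_congr fun θ => ?_
    by_cases hθ : θ ∈ Θ <;> simp [hθ]
  constructor
  · refine ⟨hm.aestronglyMeasurable, ?_⟩
    rw [hasFiniteIntegral_iff_ofReal (Eventually.of_forall h0), h1]
    exact ENNReal.one_lt_top
  · rw [integral_eq_lintegral_of_nonneg_ae (Eventually.of_forall h0) hm.aestronglyMeasurable, h1]
    simp

/-- Data for Laplace's method: the functions `f_n` have at `θ_n → θ₀` a uniform quadratic
expansion with coercive quadratic form `S`, and exceed `f_n(θ_n)` by a margin off balls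
about `θ₀`. -/
structure LaplaceSetting {D : ℕ} (Θ : Set (Euc D)) (p : Euc D → ℝ) (fn : ℕ → Euc D → ℝ)
    (θ₀ : Euc D) (θs : ℕ → Euc D) (S : Euc D →L[ℝ] Euc D →L[ℝ] ℝ) : Prop where
  measurableSet : MeasurableSet Θ
  mem_nhds : Θ ∈ 𝓝 θ₀
  density : IsProbDensityOn Θ p
  continuousAt : ContinuousAt p θ₀
  pos : 0 < p θ₀
  measurable : ∀ᶠ n in atTop, Measurable fun θ : Θ => fn n θ
  tendsto : Tendsto θs atTop (𝓝 θ₀)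
  coercive : ∃ c > 0, ∀ v, c * ‖v‖ ^ 2 ≤ S v v
  expansion : ∀ δ > 0, ∃ r > 0, ∀ᶠ n in atTop, ∀ v, ‖v‖ < r →
    |fn n (θs n + v) - fn n (θs n) - 1 / 2 * S v v| ≤ δ * ‖v‖ ^ 2
  margin : ∀ r > 0, ∃ η > 0, ∀ᶠ n in atTop, ∀ θ ∈ Θ, r ≤ ‖θ - θ₀‖ →
    fn n (θs n) + η ≤ fn n θ

/-- The two exponentials merge, so only the increment of `g` from `c` enters, to which the expansion
and the margin apply. -/
theorem rescaledWeight_of_mem {D : ℕ} {Θ : Set (Euc D)} {p g : Euc D → ℝ} {n : ℕ} {c x : Euc D}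
    (h : c + (Real.sqrt n)⁻¹ • x ∈ Θ) :
    rescaledWeight Θ p g n c x =
      Real.exp (-(n * (g (c + (Real.sqrt n)⁻¹ • x) - g c))) * p (c + (Real.sqrt n)⁻¹ • x) := by
  rw [rescaledWeight, weight, Set.indicator_of_mem h, ← mul_assoc, ← Real.exp_add]
  congr 2
  ring

theorem rescaledWeight_of_notMem {D : ℕ} {Θ : Set (Euc D)} {p g : Euc D → ℝ} {n : ℕ}
    {c x : Euc D} (h : c + (Real.sqrt n)⁻¹ • x ∉ Θ) : rescaledWeight Θ p g n c x = 0 := by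
  rw [rescaledWeight, weight, Set.indicator_of_notMem h, mul_zero]

/-- The scale `1 / √n` is the one at which `n` times a quadratic quantity does not depend on `n`. -/
theorem nat_mul_norm_rescale_sq {D n : ℕ} (hn : 0 < n) (x : Euc D) :
    (n : ℝ) * ‖(Real.sqrt n)⁻¹ • x‖ ^ 2 = ‖x‖ ^ 2 := by
  rw [norm_smul, mul_pow, norm_inv, Real.norm_of_nonneg (Real.sqrt_nonneg _), inv_pow,
    Real.sq_sqrt (Nat.cast_nonneg _)]
  field_simp

theorem nat_mul_quadForm_rescale {D n : ℕ} (hn : 0 < n) (S : Euc D →L[ℝ] Euc D →L[ℝ] ℝ)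
    (x : Euc D) :
    (n : ℝ) * S ((Real.sqrt n)⁻¹ • x) ((Real.sqrt n)⁻¹ • x) = S x x := by
  simp only [map_smul, smul_apply, smul_eq_mul]
  rw [← mul_assoc, ← mul_assoc, mul_assoc (n : ℝ), ← mul_inv,
    Real.mul_self_sqrt (Nat.cast_nonneg _), mul_inv_cancel₀ (by positivity), one_mul]

theorem tendsto_rescale (D : ℕ) (x : Euc D) :
    Tendsto (fun n : ℕ => (Real.sqrt n)⁻¹ • x) atTop (𝓝 0) := by
  have : Tendsto (fun n : ℕ => (Real.sqrt n)⁻¹) atTop (𝓝 0) :=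
    tendsto_inv_atTop_zero.comp
      (Real.tendsto_sqrt_atTop.comp tendsto_natCast_atTop_atTop)
  simpa using this.smul_const x

/-- This quantity bounds the far part: the Jacobian of the rescaling against the exponential gain
from the margin. -/
theorem tendsto_sqrt_pow_mul_exp_neg (D : ℕ) {η : ℝ} (hη : 0 < η) :
    Tendsto (fun n : ℕ => Real.sqrt n ^ D * Real.exp (-(n * η))) atTop (𝓝 0) := by
  refine ((tendsto_rpow_mul_exp_neg_mul_atTop_nhds_zero ((D : ℝ) / 2) η hη).comp
    tendsto_natCast_atTop_atTop).congr fun n => ?_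
  simp only [Function.comp_apply]
  rw [Real.sqrt_eq_rpow, ← Real.rpow_natCast, ← Real.rpow_mul (Nat.cast_nonneg _)]
  congr 2 <;> ring

/-! ### Convergence of the rescaled weights in mean -/

namespace LaplaceSetting

variable {D : ℕ} {Θ : Set (Euc D)} {p : Euc D → ℝ} {fn : ℕ → Euc D → ℝ} {θ₀ : Euc D}
  {θs : ℕ → Euc D} {S : Euc D →L[ℝ] Euc D →L[ℝ] ℝ}

/-- Pointwise convergence of the rescaled weights to a Gaussian. -/
theorem tendsto_rescaledWeight (h : LaplaceSetting Θ p fn θ₀ θs S) (x : Euc D) :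
    Tendsto (fun n => rescaledWeight Θ p (fn n) n (θs n) x) atTop
      (𝓝 (p θ₀ * Real.exp (-(1 / 2) * S x x))) := by
  have hy : Tendsto (fun n : ℕ => θs n + (Real.sqrt n)⁻¹ • x) atTop (𝓝 θ₀) := by
    simpa using h.tendsto.add (tendsto_rescale D x)
  have hpy := h.continuousAt.tendsto.comp hy
  have hexp : Tendsto (fun n : ℕ => (n : ℝ) *
      (fn n (θs n + (Real.sqrt n)⁻¹ • x) - fn n (θs n))) atTop (𝓝 (1 / 2 * S x x)) := by
    rw [Metric.tendsto_nhds]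
    intro ε hε
    -- After multiplication by `n` the error is this tolerance times `‖x‖ ^ 2`, which is below `ε`.
    obtain ⟨r, hr, hQ⟩ := h.expansion (ε / (2 * (‖x‖ ^ 2 + 1))) (by positivity)
    filter_upwards [hQ, (tendsto_rescale D x).eventually (Metric.ball_mem_nhds 0 hr),
      eventually_gt_atTop 0] with n h1 h2 h3
    have h4 := h1 _ (by simpa using h2)
    have hn : (0 : ℝ) < n := by exact_mod_cast h3
    have h5 := mul_le_mul_of_nonneg_left h4 hn.le
    rw [mul_left_comm, nat_mul_norm_rescale_sq h3, ← abs_of_pos hn, ← abs_mul, abs_of_pos hn,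
      mul_sub, mul_left_comm (n : ℝ) (1 / 2), nat_mul_quadForm_rescale h3] at h5
    rw [Real.dist_eq]
    refine h5.trans_lt ?_
    rw [div_mul_eq_mul_div, div_lt_iff₀ (by positivity)]
    nlinarith [sq_nonneg ‖x‖]
  have hlim := (Real.continuous_exp.tendsto _).comp hexp.neg
  have := hlim.mul hpy
  rw [mul_comm, ← neg_mul] at this
  refine this.congr' ?_
  filter_upwards [hy.eventually h.mem_nhds] with n hn
  exact (rescaledWeight_of_mem hn).symm

/-- The rescaled weights are dominated by a Gaussian near the origin and by an exponentially small
multiple of the rescaled prior elsewhere. -/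
theorem exists_bound (h : LaplaceSetting Θ p fn θ₀ θs S) :
    ∃ c > 0, ∃ r > 0, ∃ η > 0, (∀ v, c * ‖v‖ ^ 2 ≤ 1 / 2 * S v v) ∧ ∀ᶠ n : ℕ in atTop, ∀ x,
      (‖(Real.sqrt n)⁻¹ • x‖ < r →
        rescaledWeight Θ p (fn n) n (θs n) x ≤ 2 * p θ₀ * Real.exp (-c * ‖x‖ ^ 2)) ∧
      (r ≤ ‖(Real.sqrt n)⁻¹ • x‖ → rescaledWeight Θ p (fn n) n (θs n) x ≤
        Real.exp (-(n * η)) * Θ.indicator p (θs n + (Real.sqrt n)⁻¹ • x)) := by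
  obtain ⟨c, hc, hcS⟩ := h.coercive
  obtain ⟨r₁, hr₁, hQ⟩ := h.expansion (c / 4) (by positivity)
  have hp2 : ∀ᶠ y in 𝓝 θ₀, p y < 2 * p θ₀ :=
    h.continuousAt.eventually (gt_mem_nhds (by linarith [h.pos]))
  obtain ⟨r₂, hr₂, hball⟩ := Metric.mem_nhds_iff.1 (inter_mem h.mem_nhds hp2)
  -- With `θ_n` within `r / 2` of `θ₀`, a displacement below `r` stays in the ball of radius `r₂`,
  -- where `p < 2 * p θ₀`; a displacement of at least `r` ends at distance at least `r / 2` from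
  -- `θ₀`, where the margin holds.
  set r := min r₁ (r₂ / 2) with hr
  have hr0 : 0 < r := by positivity
  obtain ⟨η, hη, hm⟩ := h.margin (r / 2) (by positivity)
  refine ⟨c / 4, by positivity, r, hr0, η, hη, fun v => ?_, ?_⟩
  · nlinarith [hcS v, sq_nonneg ‖v‖]
  filter_upwards [hQ, hm, h.tendsto.eventually (Metric.ball_mem_nhds θ₀ (half_pos hr0)),
    eventually_gt_atTop 0] with n h1 h2 h3 h4 x
  have hn : (0 : ℝ) < n := by exact_mod_cast h4
  simp only [dist_eq_norm] at h3
  have hsplit : θs n + (Real.sqrt n)⁻¹ • x - θ₀ = (θs n - θ₀) + (Real.sqrt n)⁻¹ • x := by abel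
  constructor
  · intro hx
    have hmem := hball (show θs n + (Real.sqrt n)⁻¹ • x ∈ Metric.ball θ₀ r₂ by
      rw [mem_ball_iff_norm, hsplit]
      have := norm_add_le (θs n - θ₀) ((Real.sqrt n)⁻¹ • x)
      have := min_le_right r₁ (r₂ / 2)
      linarith)
    have hx1 := (abs_le.1 (h1 _ (hx.trans_le (min_le_left _ _)))).1
    rw [rescaledWeight_of_mem hmem.1, mul_comm]
    refine mul_le_mul hmem.2.le ?_ (Real.exp_pos _).le (by linarith [h.pos])
    rw [Real.exp_le_exp, neg_mul, neg_le_neg_iff, ← nat_mul_norm_rescale_sq h4, mul_left_comm]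
    refine mul_le_mul_of_nonneg_left ?_ hn.le
    linarith [hcS ((Real.sqrt n)⁻¹ • x)]
  · intro hx
    by_cases hmem : θs n + (Real.sqrt n)⁻¹ • x ∈ Θ
    · rw [rescaledWeight_of_mem hmem, Set.indicator_of_mem hmem]
      refine mul_le_mul_of_nonneg_right ?_ (h.density.nonneg _ hmem)
      rw [Real.exp_le_exp, neg_le_neg_iff]
      refine mul_le_mul_of_nonneg_left ?_ hn.le
      have := h2 _ hmem (by
        rw [hsplit]
        have := norm_sub_le_norm_add ((Real.sqrt n)⁻¹ • x) (θs n - θ₀)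
        rw [add_comm (θs n - θ₀)]
        linarith)
      linarith
    · rw [rescaledWeight_of_notMem hmem, Set.indicator_of_notMem hmem, mul_zero]

theorem integrable_gaussian (h : LaplaceSetting Θ p fn θ₀ θs S) :
    Integrable fun x => p θ₀ * Real.exp (-(1 / 2) * S x x) := by
  obtain ⟨c, hc, hcS⟩ := h.coercive
  refine Integrable.const_mul ?_ _
  refine (integrable_exp_neg_mul_sq_norm (D := D) (half_pos hc)).mono'
    (Continuous.aestronglyMeasurable (by fun_prop)) (Eventually.of_forall fun x => ?_)
  rw [Real.norm_of_nonneg (Real.exp_pos _).le, Real.exp_le_exp]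
  linarith [hcS x]

/-- Convergence in mean of the rescaled weights to a Gaussian. -/
theorem tendsto_integral_abs_sub (h : LaplaceSetting Θ p fn θ₀ θs S) :
    (∀ᶠ n : ℕ in atTop, Integrable (rescaledWeight Θ p (fn n) n (θs n))) ∧
    Tendsto (fun n : ℕ => ∫ x, |rescaledWeight Θ p (fn n) n (θs n) x -
      p θ₀ * Real.exp (-(1 / 2) * S x x)|) atTop (𝓝 0) := by
  obtain ⟨c, hc, r, hr, η, hη, hcS, hbound⟩ := h.exists_bound
  obtain ⟨hPi, hP1⟩ := h.density.integrable_indicator h.measurableSet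
  have hgauss := integrable_exp_neg_mul_sq_norm (D := D) hc
  have hnn := fun n x => rescaledWeight_nonneg h.density.nonneg (fn n) n (θs n) x
  have hP0 : ∀ θ, 0 ≤ Θ.indicator p θ := Set.indicator_nonneg h.density.nonneg
  have hmeas : ∀ᶠ n in atTop, Measurable (rescaledWeight Θ p (fn n) n (θs n)) := by
    filter_upwards [h.measurable] with n hn
    exact measurable_rescaledWeight h.measurableSet h.density.measurable hn
  have htail : ∀ᶠ n : ℕ in atTop, Integrable fun x : Euc D =>
      Real.exp (-(n * η)) * Θ.indicator p (θs n + (Real.sqrt n)⁻¹ • x) := by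
    filter_upwards [eventually_gt_atTop 0] with n hn
    exact ((integrable_comp_rescale_iff hn _ _).2 hPi).const_mul _
  have hint : ∀ᶠ n : ℕ in atTop, Integrable (rescaledWeight Θ p (fn n) n (θs n)) := by
    filter_upwards [hbound, hmeas, htail] with n h1 h2 h3
    refine ((hgauss.const_mul (2 * p θ₀)).add h3).mono' h2.aestronglyMeasurable
      (Eventually.of_forall fun x => ?_)
    rw [Real.norm_of_nonneg (hnn n x)]
    have a1 : 0 ≤ 2 * p θ₀ * Real.exp (-c * ‖x‖ ^ 2) :=
      mul_nonneg (by linarith [h.pos]) (Real.exp_pos _).le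
    have a2 := mul_nonneg (Real.exp_pos (-(n * η))).le (hP0 (θs n + (Real.sqrt n)⁻¹ • x))
    simp only [Pi.add_apply]
    rcases lt_or_ge ‖(Real.sqrt n)⁻¹ • x‖ r with hx | hx
    · linarith [(h1 x).1 hx]
    · linarith [(h1 x).2 hx]
  refine ⟨hint, ?_⟩
  have hAm : ∀ n : ℕ, MeasurableSet {x : Euc D | ‖(Real.sqrt n)⁻¹ • x‖ < r} := fun n =>
    measurableSet_lt (by fun_prop) measurable_const
  -- Near part, by dominated convergence. The factor `3` adds the bound `2` for the weight and `1`
  -- for the limiting Gaussian.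
  have hcore : Tendsto (fun n : ℕ => ∫ x, |{x : Euc D | ‖(Real.sqrt n)⁻¹ • x‖ < r}.indicator
      (rescaledWeight Θ p (fn n) n (θs n)) x - p θ₀ * Real.exp (-(1 / 2) * S x x)|)
      atTop (𝓝 (∫ _ : Euc D, (0 : ℝ))) := by
    refine tendsto_integral_filter_of_dominated_convergence
      (fun x => 3 * p θ₀ * Real.exp (-c * ‖x‖ ^ 2)) ?_ ?_ (hgauss.const_mul _) ?_
    · filter_upwards [hmeas] with n hn
      exact (((hn.indicator (hAm n)).sub (by fun_prop)).abs).aestronglyMeasurable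
    · filter_upwards [hbound] with n h1
      refine Eventually.of_forall fun x => ?_
      have a1 : p θ₀ * Real.exp (-(1 / 2) * S x x) ≤ p θ₀ * Real.exp (-c * ‖x‖ ^ 2) :=
        mul_le_mul_of_nonneg_left (Real.exp_le_exp.2 (by linarith [hcS x])) h.pos.le
      have a2 : 0 ≤ p θ₀ * Real.exp (-(1 / 2) * S x x) := mul_nonneg h.pos.le (Real.exp_pos _).le
      have a3 : {x : Euc D | ‖(Real.sqrt n)⁻¹ • x‖ < r}.indicator
          (rescaledWeight Θ p (fn n) n (θs n)) x ≤ 2 * p θ₀ * Real.exp (-c * ‖x‖ ^ 2) := by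
        refine Set.indicator_le' (fun x hx => (h1 x).1 hx) (fun x _ => ?_) x
        exact mul_nonneg (by linarith [h.pos]) (Real.exp_pos _).le
      have a4 : 0 ≤ {x : Euc D | ‖(Real.sqrt n)⁻¹ • x‖ < r}.indicator
          (rescaledWeight Θ p (fn n) n (θs n)) x := Set.indicator_nonneg (fun x _ => hnn n x) x
      rw [Real.norm_eq_abs, abs_abs, abs_le]
      constructor <;> linarith
    · refine Eventually.of_forall fun x => ?_
      have h1 : Tendsto (fun n : ℕ => {x : Euc D | ‖(Real.sqrt n)⁻¹ • x‖ < r}.indicator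
          (rescaledWeight Θ p (fn n) n (θs n)) x) atTop
          (𝓝 (p θ₀ * Real.exp (-(1 / 2) * S x x))) := by
        refine (h.tendsto_rescaledWeight x).congr' ?_
        filter_upwards [(tendsto_rescale D x).eventually (Metric.ball_mem_nhds 0 hr)] with n hn
        rw [Set.indicator_of_mem]
        simpa using hn
      simpa using (h1.sub_const (p θ₀ * Real.exp (-(1 / 2) * S x x))).abs
  have hsum := hcore.add (tendsto_sqrt_pow_mul_exp_neg D hη)
  simp only [integral_zero, add_zero] at hsum
  refine squeeze_zero' (Eventually.of_forall fun n => integral_nonneg fun x => abs_nonneg _) ?_ hsum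
  filter_upwards [hbound, hint, htail] with n h1 h2 h3
  have hG := h.integrable_gaussian
  have i1 : Integrable fun x => |{x : Euc D | ‖(Real.sqrt n)⁻¹ • x‖ < r}.indicator
      (rescaledWeight Θ p (fn n) n (θs n)) x - p θ₀ * Real.exp (-(1 / 2) * S x x)| :=
    ((h2.indicator (hAm n)).sub hG).abs
  have e1 : ∫ x, Real.exp (-(n * η)) * Θ.indicator p (θs n + (Real.sqrt n)⁻¹ • x)
      = Real.sqrt n ^ D * Real.exp (-(n * η)) := by
    rw [integral_const_mul, integral_comp_rescale, hP1]
    ring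
  rw [← e1, ← integral_add i1 h3]
  -- Outside the near region the truncated difference is the Gaussian alone, and the weight itself
  -- is paid for by the prior term.
  refine integral_mono (h2.sub hG).abs (i1.add h3) fun x => ?_
  have a2 := mul_nonneg (Real.exp_pos (-(n * η))).le (hP0 (θs n + (Real.sqrt n)⁻¹ • x))
  simp only
  rcases lt_or_ge ‖(Real.sqrt n)⁻¹ • x‖ r with hx | hx
  · rw [Set.indicator_of_mem (show x ∈ {x : Euc D | ‖(Real.sqrt n)⁻¹ • x‖ < r} from hx)]
    linarith
  · rw [Set.indicator_of_notMem (show x ∉ {x : Euc D | ‖(Real.sqrt n)⁻¹ • x‖ < r} from hx.not_gt)]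
    have a3 := (h1 x).2 hx
    have a4 : 0 ≤ p θ₀ * Real.exp (-(1 / 2) * S x x) := mul_nonneg h.pos.le (Real.exp_pos _).le
    rw [zero_sub, abs_neg, abs_of_nonneg a4]
    have a5 := abs_sub (rescaledWeight Θ p (fn n) n (θs n) x) (p θ₀ * Real.exp (-(1 / 2) * S x x))
    rw [abs_of_nonneg (hnn n x), abs_of_nonneg a4] at a5
    linarith

end LaplaceSetting

/-! ### The law of the rescaled posterior -/

theorem normConst_eq_integral_weight {D : ℕ} {Θ : Set (Euc D)} (hΘ : MeasurableSet Θ)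
    (p g : Euc D → ℝ) (n : ℕ) : normConst Θ p g n = ∫ θ, weight Θ p g n θ :=
  (integral_indicator hΘ).symm

theorem postDensity_eq_weight_div {D : ℕ} (Θ : Set (Euc D)) (p g : Euc D → ℝ) (n : ℕ)
    (θ : Euc D) : postDensity Θ p g n θ = weight Θ p g n θ / normConst Θ p g n := by
  by_cases h : θ ∈ Θ <;> simp [postDensity, weight, h]

theorem integral_rescaledWeight {D : ℕ} {Θ : Set (Euc D)} (hΘ : MeasurableSet Θ)
    (p g : Euc D → ℝ) (n : ℕ) (c : Euc D) :
    ∫ x, rescaledWeight Θ p g n c x =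
      Real.exp (n * g c) * (Real.sqrt n ^ D * normConst Θ p g n) := by
  simp only [rescaledWeight]
  rw [integral_const_mul, integral_comp_rescale, normConst_eq_integral_weight hΘ]

theorem integrable_weight_of_rescaledWeight {D : ℕ} {Θ : Set (Euc D)} {p g : Euc D → ℝ} {n : ℕ}
    {c : Euc D} (hn : 0 < n) (h : Integrable (rescaledWeight Θ p g n c)) :
    Integrable (weight Θ p g n) := by
  rw [← integrable_comp_rescale_iff hn _ c]
  exact (integrable_const_mul_iff (isUnit_iff_ne_zero.2 (Real.exp_ne_zero _)) _).1 h

/-- The version for extended nonnegative functions identifies the pushforward density without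
integrability assumptions. -/
theorem lintegral_comp_rescale {D n : ℕ} (hn : 0 < n) {F : Euc D → ENNReal} (hF : Measurable F)
    (c : Euc D) :
    ∫⁻ x, F (c + (Real.sqrt n)⁻¹ • x) = ENNReal.ofReal (Real.sqrt n ^ D) * ∫⁻ θ, F θ := by
  have h : (Real.sqrt n)⁻¹ ≠ 0 := by positivity
  have h1 : ∫⁻ x, F (c + (Real.sqrt n)⁻¹ • x) =
      ∫⁻ y, F (c + y) ∂(Measure.map (fun x : Euc D => (Real.sqrt n)⁻¹ • x) volume) :=
    (lintegral_map (f := fun y => F (c + y)) (by fun_prop) (by fun_prop)).symm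
  rw [h1, Measure.map_addHaar_smul _ h, lintegral_smul_measure, lintegral_add_left_eq_self,
    finrank_euclideanSpace_fin, inv_pow, inv_inv, abs_of_nonneg (by positivity), smul_eq_mul]

/-- Density of the image of a measure with density under `θ ↦ √n (θ - c)`. -/
theorem map_withDensity_rescale {D n : ℕ} (hn : 0 < n) {F : Euc D → ENNReal} (hF : Measurable F)
    (c : Euc D) :
    (volume.withDensity F).map (fun θ => Real.sqrt n • (θ - c)) = volume.withDensity fun x =>
      ENNReal.ofReal (Real.sqrt n ^ D)⁻¹ * F (c + (Real.sqrt n)⁻¹ • x) := by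
  have hs : Real.sqrt n ≠ 0 := by positivity
  have hm : Measurable fun θ : Euc D => Real.sqrt n • (θ - c) := by fun_prop
  ext s hs'
  rw [Measure.map_apply hm hs', withDensity_apply _ (hm hs'), withDensity_apply _ hs',
    lintegral_const_mul _ (by fun_prop), ← lintegral_indicator (hm hs'),
    ← lintegral_indicator hs']
  have h1 : ∀ x, s.indicator (fun x => F (c + (Real.sqrt n)⁻¹ • x)) x =
      ((fun θ : Euc D => Real.sqrt n • (θ - c)) ⁻¹' s).indicator F (c + (Real.sqrt n)⁻¹ • x) := by
    intro x
    by_cases hx : x ∈ s <;> simp [hx, Set.indicator, smul_smul, hs]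
  simp_rw [h1]
  rw [lintegral_comp_rescale hn (hF.indicator (hm hs')), ← mul_assoc,
    ← ENNReal.ofReal_mul (by positivity), inv_mul_cancel₀ (by positivity), ENNReal.ofReal_one,
    one_mul]

/-- The rescaled posterior density is the normalized rescaled weight. -/
theorem rescaledDensity_ae_eq {D n : ℕ} {Θ : Set (Euc D)} {p g : Euc D → ℝ} (hn : 0 < n)
    (hΘ : MeasurableSet Θ) (hp : IsProbDensityOn Θ p) (hg : Measurable fun θ : Θ => g θ)
    (c : Euc D) :
    rescaledDensity Θ p g n c =ᵐ[volume] fun x =>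
      rescaledWeight Θ p g n c x / ∫ y, rescaledWeight Θ p g n c y := by
  have hw := measurable_weight (n := n) hΘ hp.measurable hg
  have hF : Measurable fun θ => ENNReal.ofReal (postDensity Θ p g n θ) := by
    simp_rw [postDensity_eq_weight_div]
    exact (hw.div_const _).ennreal_ofReal
  have h1 := map_withDensity_rescale hn hF c
  have h2 := Measure.rnDeriv_withDensity (volume : Measure (Euc D)) (f := fun x =>
      ENNReal.ofReal (Real.sqrt n ^ D)⁻¹ *
        ENNReal.ofReal (postDensity Θ p g n (c + (Real.sqrt n)⁻¹ • x)))
    ((hF.comp (show Measurable fun x : Euc D => c + (Real.sqrt n)⁻¹ • x by fun_prop)).const_mul _)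
  filter_upwards [h2] with x hx
  have hz : 0 ≤ normConst Θ p g n := by
    rw [normConst_eq_integral_weight hΘ]
    exact integral_nonneg fun θ => weight_nonneg hp.nonneg g n θ
  have hpos : 0 ≤ postDensity Θ p g n (c + (Real.sqrt n)⁻¹ • x) := by
    rw [postDensity_eq_weight_div]
    exact div_nonneg (weight_nonneg hp.nonneg g n _) hz
  have hs : Real.sqrt n ^ D ≠ 0 := by positivity
  -- The factor `exp (n g(c))` cancels between the weight and its integral, leaving the Jacobian `√n
  -- ^ D` times the normalizing constant.
  rw [rescaledDensity, postMeasure, h1, hx, ENNReal.toReal_mul,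
    ENNReal.toReal_ofReal (by positivity), ENNReal.toReal_ofReal hpos,
    integral_rescaledWeight hΘ, rescaledWeight, mul_div_mul_left _ _ (Real.exp_ne_zero _),
    postDensity_eq_weight_div]
  field_simp

/-! ### Normalizing constants, concentration and asymptotic normality -/

namespace LaplaceSetting

variable {D : ℕ} {Θ : Set (Euc D)} {p : Euc D → ℝ} {fn : ℕ → Euc D → ℝ} {θ₀ : Euc D}
  {θs : ℕ → Euc D} {S : Euc D →L[ℝ] Euc D →L[ℝ] ℝ}

theorem integral_gaussian_pos (h : LaplaceSetting Θ p fn θ₀ θs S) :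
    0 < ∫ x, p θ₀ * Real.exp (-(1 / 2) * S x x) := by
  refine integral_pos_of_integrable_nonneg_nonzero (x := 0) (by fun_prop) h.integrable_gaussian
    (fun x => mul_nonneg h.pos.le (Real.exp_pos _).le) ?_
  exact (mul_pos h.pos (Real.exp_pos _)).ne'

/-- This integral is `z_n` times `√n ^ D exp (n f_n(θ_n))`, so its limit already is the Laplace
approximation in unnormalized form. -/
theorem tendsto_integral_rescaledWeight (h : LaplaceSetting Θ p fn θ₀ θs S) :
    Tendsto (fun n : ℕ => ∫ x, rescaledWeight Θ p (fn n) n (θs n) x) atTop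
      (𝓝 (∫ x, p θ₀ * Real.exp (-(1 / 2) * S x x))) := by
  obtain ⟨hint, hlim⟩ := h.tendsto_integral_abs_sub
  rw [tendsto_iff_norm_sub_tendsto_zero]
  refine squeeze_zero' (Eventually.of_forall fun n => norm_nonneg _) ?_ hlim
  filter_upwards [hint] with n hn
  rw [← integral_sub hn h.integrable_gaussian]
  exact norm_integral_le_integral_norm _

/-- The limiting Gaussian integral is positive, so the rescaled integrals eventually are, and `z_n`
differs from them by positive factors. -/
theorem eventually_integrable_and_pos (h : LaplaceSetting Θ p fn θ₀ θs S) :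
    ∀ᶠ n : ℕ in atTop, IntegrableOn (fun θ => Real.exp (-(n : ℝ) * fn n θ) * p θ) Θ ∧
      0 < normConst Θ p (fn n) n := by
  filter_upwards [h.tendsto_integral_abs_sub.1, eventually_gt_atTop 0,
    h.tendsto_integral_rescaledWeight.eventually (lt_mem_nhds h.integral_gaussian_pos)]
    with n h1 h2 h3
  refine ⟨(integrable_indicator_iff h.measurableSet).1
    (integrable_weight_of_rescaledWeight h2 h1), ?_⟩
  rw [integral_rescaledWeight h.measurableSet] at h3
  exact pos_of_mul_pos_right (pos_of_mul_pos_right h3 (Real.exp_pos _).le) (by positivity)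

/-- Posterior concentration. -/
theorem tendsto_integral_ball (h : LaplaceSetting Θ p fn θ₀ θs S) {ε : ℝ} (hε : 0 < ε) :
    Tendsto (fun n : ℕ => ∫ θ in Metric.ball θ₀ ε, postDensity Θ p (fn n) n θ) atTop (𝓝 1) := by
  obtain ⟨η, hη, hm⟩ := h.margin ε hε
  obtain ⟨hPi, hP1⟩ := h.density.integrable_indicator h.measurableSet
  have hP0 : ∀ θ, 0 ≤ Θ.indicator p θ := Set.indicator_nonneg h.density.nonneg
  -- The mass off the ball is at most `exp (-n (f_n(θ_n) + η))`; divided by `z_n`, it becomes the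
  -- quotient considered here.
  have hbound := (tendsto_sqrt_pow_mul_exp_neg D hη).div h.tendsto_integral_rescaledWeight
    h.integral_gaussian_pos.ne'
  rw [zero_div] at hbound
  have htail : Tendsto (fun n : ℕ => ∫ θ in (Metric.ball θ₀ ε)ᶜ, postDensity Θ p (fn n) n θ)
      atTop (𝓝 0) := by
    refine squeeze_zero' ?_ ?_ hbound
    · filter_upwards [h.eventually_integrable_and_pos] with n hn
      refine integral_nonneg fun θ => ?_
      rw [postDensity_eq_weight_div]
      exact div_nonneg (weight_nonneg h.density.nonneg _ _ _) hn.2.le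
    · filter_upwards [h.eventually_integrable_and_pos, hm, eventually_gt_atTop 0] with n hn h1 h2
      have hn0 : (0 : ℝ) < n := by exact_mod_cast h2
      have hw : Integrable (weight Θ p (fn n) n) :=
        (integrable_indicator_iff h.measurableSet).2 hn.1
      have h3 : ∫ θ in (Metric.ball θ₀ ε)ᶜ, weight Θ p (fn n) n θ ≤
          Real.exp (-(n * (fn n (θs n) + η))) := by
        calc ∫ θ in (Metric.ball θ₀ ε)ᶜ, weight Θ p (fn n) n θ
            ≤ ∫ θ in (Metric.ball θ₀ ε)ᶜ,
                Real.exp (-(n * (fn n (θs n) + η))) * Θ.indicator p θ := by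
              refine setIntegral_mono_on hw.integrableOn (hPi.const_mul _).integrableOn
                Metric.isOpen_ball.measurableSet.compl fun θ hθ => ?_
              by_cases hθΘ : θ ∈ Θ
              · rw [weight, Set.indicator_of_mem hθΘ, Set.indicator_of_mem hθΘ, neg_mul]
                refine mul_le_mul_of_nonneg_right ?_ (h.density.nonneg θ hθΘ)
                rw [Real.exp_le_exp, neg_le_neg_iff]
                refine mul_le_mul_of_nonneg_left (h1 θ hθΘ ?_) hn0.le
                rwa [Set.mem_compl_iff, mem_ball_iff_norm, not_lt] at hθ
              · simp [weight, hθΘ]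
          _ ≤ ∫ θ, Real.exp (-(n * (fn n (θs n) + η))) * Θ.indicator p θ :=
              setIntegral_le_integral (hPi.const_mul _)
                (Eventually.of_forall fun θ => mul_nonneg (Real.exp_pos _).le (hP0 θ))
          _ = _ := by rw [integral_const_mul, hP1, mul_one]
      simp_rw [postDensity_eq_weight_div]
      rw [Pi.div_apply, integral_div, integral_rescaledWeight h.measurableSet]
      have hz := hn.2
      have hs : 0 < Real.sqrt n ^ D := by positivity
      rw [div_le_div_iff₀ hz (by positivity)]
      have h4 : Real.exp (-(n * (fn n (θs n) + η))) * Real.exp (n * fn n (θs n)) =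
          Real.exp (-(n * η)) := by
        rw [← Real.exp_add]
        congr 1
        ring
      calc _ ≤ Real.exp (-(n * (fn n (θs n) + η))) *
            (Real.exp (n * fn n (θs n)) * (Real.sqrt n ^ D * normConst Θ p (fn n) n)) :=
            mul_le_mul_of_nonneg_right h3 (by positivity)
        _ = _ := by rw [← mul_assoc, h4]; ring
  have := htail.const_sub 1
  rw [sub_zero] at this
  refine this.congr' ?_
  filter_upwards [h.eventually_integrable_and_pos] with n hn
  have hw : Integrable (weight Θ p (fn n) n) :=
    (integrable_indicator_iff h.measurableSet).2 hn.1
  have hsum := integral_add_compl (Metric.isOpen_ball (x := θ₀) (ε := ε)).measurableSet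
    (f := postDensity Θ p (fn n) n) (μ := volume) (by
      rw [show postDensity Θ p (fn n) n = fun θ => weight Θ p (fn n) n θ / normConst Θ p (fn n) n
        from funext (postDensity_eq_weight_div Θ p (fn n) n)]
      exact hw.div_const _)
  have h1 : ∫ θ, postDensity Θ p (fn n) n θ = 1 := by
    simp_rw [postDensity_eq_weight_div]
    rw [integral_div, ← normConst_eq_integral_weight h.measurableSet, div_self hn.2.ne']
  linarith

/-- The value of the limiting Gaussian integral. -/
theorem integral_gaussian_eq (p₀ : ℝ) {H : Matrix (Fin D) (Fin D) ℝ} (hH : H.PosDef)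
    (hS : ∀ v : Euc D, v.ofLp ⬝ᵥ H.mulVec v.ofLp = S v v) :
    ∫ x, p₀ * Real.exp (-(1 / 2) * S x x) =
      p₀ * ((2 * Real.pi) ^ ((D : ℝ) / 2) / Real.sqrt H.det) := by
  rw [integral_const_mul, ← integral_exp_neg_half_quadForm hH]
  simp_rw [hS]

/-- Laplace's approximation of the normalizing constants. -/
theorem tendsto_normConst_div (h : LaplaceSetting Θ p fn θ₀ θs S)
    {H : Matrix (Fin D) (Fin D) ℝ} (hH : H.PosDef)
    (hS : ∀ v : Euc D, v.ofLp ⬝ᵥ H.mulVec v.ofLp = S v v) :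
    Tendsto (fun n : ℕ => normConst Θ p (fn n) n /
      (Real.exp (-(n : ℝ) * fn n (θs n)) * p θ₀ / Real.sqrt |H.det| *
        (2 * Real.pi / n) ^ ((D : ℝ) / 2))) atTop (𝓝 1) := by
  have h1 := h.tendsto_integral_rescaledWeight.div_const
    (∫ x, p θ₀ * Real.exp (-(1 / 2) * S x x))
  rw [div_self h.integral_gaussian_pos.ne'] at h1
  refine h1.congr' ?_
  filter_upwards [eventually_gt_atTop 0] with n hn
  have hn0 : (0 : ℝ) < n := by exact_mod_cast hn
  have hdet := hH.det_pos
  have hp0 := h.pos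
  have hsq : (n : ℝ) ^ ((D : ℝ) / 2) = Real.sqrt n ^ D := by
    rw [Real.sqrt_eq_rpow, ← Real.rpow_natCast, ← Real.rpow_mul hn0.le]
    congr 1
    ring
  rw [integral_rescaledWeight h.measurableSet, integral_gaussian_eq _ hH hS,
    abs_of_pos hdet, Real.div_rpow (by positivity) hn0.le, hsq, neg_mul, Real.exp_neg]
  have h2 : 0 < (2 * Real.pi) ^ ((D : ℝ) / 2) := Real.rpow_pos_of_pos (by positivity) _
  have h3 : 0 < Real.sqrt H.det := Real.sqrt_pos.2 hdet
  have h4 : 0 < Real.sqrt n ^ D := by positivity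
  field_simp

/-- The arbitrary factor `p₀` cancels; this form matches the rescaled posterior density, a weight
over its integral. -/
theorem normalDensity_eq (p₀ : ℝ) (hp₀ : p₀ ≠ 0) {H : Matrix (Fin D) (Fin D) ℝ} (hH : H.PosDef)
    (hS : ∀ v : Euc D, v.ofLp ⬝ᵥ H.mulVec v.ofLp = S v v) (x : Euc D) :
    normalDensity 0 H⁻¹ x = p₀ * Real.exp (-(1 / 2) * S x x) /
      ∫ y, p₀ * Real.exp (-(1 / 2) * S y y) := by
  have hdet := hH.det_pos
  rw [integral_gaussian_eq _ hH hS, normalDensity, sub_zero,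
    Matrix.nonsing_inv_nonsing_inv _ (isUnit_iff_ne_zero.2 hdet.ne'), hS,
    Matrix.det_nonsing_inv, Ring.inverse_eq_inv, Real.sqrt_inv]
  have h2 : 0 < (2 * Real.pi) ^ ((D : ℝ) / 2) := Real.rpow_pos_of_pos (by positivity) _
  have h3 : 0 < Real.sqrt H.det := Real.sqrt_pos.2 hdet
  field_simp

/-- Asymptotic normality in total variation. -/
theorem tendsto_lintegral_abs_sub_normalDensity (h : LaplaceSetting Θ p fn θ₀ θs S)
    {H : Matrix (Fin D) (Fin D) ℝ} (hH : H.PosDef)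
    (hS : ∀ v : Euc D, v.ofLp ⬝ᵥ H.mulVec v.ofLp = S v v) :
    Tendsto (fun n : ℕ => ∫⁻ x, ENNReal.ofReal
      |rescaledDensity Θ p (fn n) n (θs n) x - normalDensity 0 H⁻¹ x|) atTop (𝓝 0) := by
  set G : Euc D → ℝ := fun x => p θ₀ * Real.exp (-(1 / 2) * S x x)
  have hGi : Integrable G := h.integrable_gaussian
  have hG0 : ∀ x, 0 ≤ G x := fun x => mul_nonneg h.pos.le (Real.exp_pos _).le
  have hI : 0 < ∫ x, G x := h.integral_gaussian_pos
  have hint := h.tendsto_integral_abs_sub.1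
  have hlim : Tendsto (fun n : ℕ => ∫ x, |rescaledWeight Θ p (fn n) n (θs n) x - G x|) atTop
    (𝓝 0) := h.tendsto_integral_abs_sub.2
  have hIn : Tendsto (fun n : ℕ => ∫ x, rescaledWeight Θ p (fn n) n (θs n) x) atTop
    (𝓝 (∫ x, G x)) := h.tendsto_integral_rescaledWeight
  have hinv := hIn.inv₀ hI.ne'
  -- The difference of the quotients `w / I_n - G / I` is split as `I_n⁻¹ (w - G) + (I_n⁻¹ - I⁻¹)
  -- G`; the two summands bound the `L¹` norms of these pieces.
  have hb : Tendsto (fun n : ℕ =>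
      |(∫ x, rescaledWeight Θ p (fn n) n (θs n) x)⁻¹| *
        (∫ x, |rescaledWeight Θ p (fn n) n (θs n) x - G x|) +
      |(∫ x, rescaledWeight Θ p (fn n) n (θs n) x)⁻¹ - (∫ x, G x)⁻¹| * ∫ x, G x)
      atTop (𝓝 0) := by
    have h1 := hinv.abs.mul hlim
    have h2 := ((hinv.sub_const (∫ x, G x)⁻¹).abs).mul_const (∫ x, G x)
    simpa only [mul_zero, zero_mul, sub_self, abs_zero, add_zero] using h1.add h2
  have hb' := ENNReal.tendsto_ofReal hb
  rw [ENNReal.ofReal_zero] at hb'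
  refine tendsto_of_tendsto_of_tendsto_of_le_of_le' tendsto_const_nhds hb'
    (Eventually.of_forall fun n => zero_le) ?_
  filter_upwards [hint, eventually_gt_atTop 0, h.measurable] with n h1 h2 h3
  have i1 : Integrable fun x => |(∫ x, rescaledWeight Θ p (fn n) n (θs n) x)⁻¹| *
      |rescaledWeight Θ p (fn n) n (θs n) x - G x| := (h1.sub hGi).abs.const_mul _
  have i2 : Integrable fun x => |(∫ x, rescaledWeight Θ p (fn n) n (θs n) x)⁻¹ -
      (∫ x, G x)⁻¹| * G x := hGi.const_mul _
  have e0 := ofReal_integral_eq_lintegral_ofReal (i1.add i2) (Eventually.of_forall fun x =>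
    add_nonneg (mul_nonneg (abs_nonneg _) (abs_nonneg _)) (mul_nonneg (abs_nonneg _) (hG0 x)))
  simp only [Pi.add_apply] at e0
  rw [← integral_const_mul, ← integral_const_mul, ← integral_add i1 i2, e0]
  refine lintegral_mono_ae ?_
  -- The rescaled density is a Radon–Nikodym derivative, hence known only almost everywhere.
  filter_upwards [rescaledDensity_ae_eq h2 h.measurableSet h.density h3 (θs n)] with x hx
  refine ENNReal.ofReal_le_ofReal ?_
  rw [hx, normalDensity_eq (p θ₀) h.pos.ne' hH hS]
  have e1 : rescaledWeight Θ p (fn n) n (θs n) x / (∫ y, rescaledWeight Θ p (fn n) n (θs n) y) -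
      G x / (∫ y, G y) = (∫ x, rescaledWeight Θ p (fn n) n (θs n) x)⁻¹ *
        (rescaledWeight Θ p (fn n) n (θs n) x - G x) +
      ((∫ x, rescaledWeight Θ p (fn n) n (θs n) x)⁻¹ - (∫ x, G x)⁻¹) * G x := by
    rw [div_eq_mul_inv, div_eq_mul_inv]
    ring
  refine (congrArg abs e1).le.trans ((abs_add_le _ _).trans (le_of_eq ?_))
  rw [abs_mul, abs_mul, abs_of_nonneg (hG0 x)]

end LaplaceSetting

end GenPosterior

end

/-! ### The main theorem -/

theorem theorem4 (D : ℕ) (Θ E : Set (GenPosterior.Euc D)) (θ₀ : GenPosterior.Euc D)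
    (p : GenPosterior.Euc D → ℝ) (fn : ℕ → GenPosterior.Euc D → ℝ)
    (f : GenPosterior.Euc D → ℝ)
    (hΘ : MeasurableSet Θ) (hEΘ : E ⊆ Θ) (hEo : IsOpen E) (hEb : Bornology.IsBounded E)
    (hθ₀ : θ₀ ∈ E)
    (hp : GenPosterior.IsProbDensityOn Θ p) (hpc : ContinuousAt p θ₀) (hp0 : 0 < p θ₀)
    (hfm : ∀ n, 1 ≤ n → Measurable fun θ : Θ => fn n θ)
    (hf3 : ∀ n, 1 ≤ n → ContDiffOn ℝ 3 (fn n) E)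
    (hlim : ∀ θ ∈ Θ, Tendsto (fun n => fn n θ) atTop (𝓝 (f θ)))
    (hH : (GenPosterior.hessian f θ₀).PosDef)
    (hb : ∃ C : ℝ, ∀ n, 1 ≤ n → ∀ θ ∈ E,
      GenPosterior.tensorNorm (GenPosterior.thirdDeriv (fn n) θ) ≤ C) :
    (GenPosterior.SeparationCond Θ E θ₀ fn f ∨ GenPosterior.ConvexCond Θ θ₀ fn f →
      ∃ θs : ℕ → GenPosterior.Euc D,
        (∀ n, θs n ∈ Θ) ∧
        Tendsto θs atTop (𝓝 θ₀) ∧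
        (∀ᶠ n : ℕ in atTop, HasGradientAt (fn n) 0 (θs n)) ∧
        Tendsto (fun n => fn n (θs n)) atTop (𝓝 (f θ₀)) ∧
        -- the normalizing constants are finite and positive for all large `n`
        (∀ᶠ n : ℕ in atTop,
          IntegrableOn (fun θ => Real.exp (-(n : ℝ) * fn n θ) * p θ) Θ ∧
          0 < GenPosterior.normConst Θ p (fn n) n) ∧
        -- concentration at `θ₀`
        (∀ ε > 0, Tendsto
          (fun n : ℕ => ∫ θ in Metric.ball θ₀ ε, GenPosterior.postDensity Θ p (fn n) n θ)
          atTop (𝓝 1)) ∧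
        -- Laplace approximation
        Tendsto (fun n : ℕ => GenPosterior.normConst Θ p (fn n) n /
            (Real.exp (-(n : ℝ) * fn n (θs n)) * p θ₀ /
                Real.sqrt |(GenPosterior.hessian f θ₀).det| *
              (2 * Real.pi / n) ^ ((D : ℝ) / 2)))
          atTop (𝓝 1) ∧
        -- asymptotic normality in total variation
        Tendsto (fun n : ℕ => ∫⁻ x, ENNReal.ofReal
            |GenPosterior.rescaledDensity Θ p (fn n) n (θs n) x -
              GenPosterior.normalDensity 0 (GenPosterior.hessian f θ₀)⁻¹ x|)
          atTop (𝓝 0)) ∧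
    (GenPosterior.ConvexCond Θ θ₀ fn f → GenPosterior.SeparationCond Θ E θ₀ fn f) := by
  obtain ⟨C, hC⟩ := hb
  have hf3' : ∀ᶠ n in atTop, ContDiffOn ℝ 3 (fn n) E :=
    (eventually_ge_atTop 1).mono hf3
  have hlimE : ∀ y ∈ E, Tendsto (fun n => fn n y) atTop (𝓝 (f y)) := fun y hy => hlim y (hEΘ hy)
  have hreg := fun x (hx : x ∈ E) => GenPosterior.tendsto_fderiv_of_bounded_third hEo hx hf3'
    (C := D ^ 3 * C) (by
      filter_upwards [eventually_ge_atTop 1] with n hn y hy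
      exact (GenPosterior.norm_fderiv_third_le _ _).trans
        (mul_le_mul_of_nonneg_left (hC n hn y hy) (by positivity))) hlimE
  have hjoint := fun x (hx : x ∈ E) => (hreg x hx).1
  obtain ⟨-, hS, hd, hd2⟩ := hreg θ₀ hθ₀
  have hquad := GenPosterior.hessian_quadForm f θ₀
  have hpos : ∀ v, v ≠ 0 → 0 < fderiv ℝ (fderiv ℝ f) θ₀ v v := by
    intro v hv
    rw [← hquad v]
    simpa using hH.dotProduct_mulVec_pos (x := v.ofLp) (by simpa using hv)
  have hcs : GenPosterior.ConvexCond Θ θ₀ fn f → GenPosterior.SeparationCond Θ E θ₀ fn f :=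
    fun h => h.separationCond hEΘ hEo hθ₀ hjoint (hlim θ₀ (hEΘ hθ₀)) hd hd2 hpos
  refine ⟨fun h12 => ?_, hcs⟩
  have hsep := h12.elim id hcs
  have hmargin := fun r (hr : 0 < r) => hsep.exists_margin hjoint hr
  obtain ⟨θs, hθsE, hθs, hmin⟩ := GenPosterior.exists_tendsto_isLocalMin hEo hθ₀
    (hf3'.mono fun n hn => hn.continuousOn) (hlim θ₀ (hEΘ hθ₀)) (fun r hr => by
      obtain ⟨η, hη, h⟩ := hmargin r hr
      exact ⟨η, hη, h.mono fun n hn y hy => hn y (hEΘ hy)⟩)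
  have hcrit : ∀ᶠ n in atTop, fderiv ℝ (fn n) (θs n) = 0 := hmin.mono fun n hn => hn.fderiv_eq_zero
  have hval : Tendsto (fun n => fn n (θs n)) atTop (𝓝 (f θ₀)) :=
    (hjoint θ₀ hθ₀).comp (tendsto_id.prodMk hθs)
  have hset : GenPosterior.LaplaceSetting Θ p fn θ₀ θs (fderiv ℝ (fderiv ℝ f) θ₀) :=
    { measurableSet := hΘ
      mem_nhds := mem_of_superset (hEo.mem_nhds hθ₀) hEΘ
      density := hp
      continuousAt := hpc
      pos := hp0
      measurable := (eventually_ge_atTop 1).mono hfm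
      tendsto := hθs
      coercive := GenPosterior.exists_coercive _ hpos
      expansion := fun δ hδ =>
        GenPosterior.exists_quadratic_expansion hEo hθ₀ hf3' hS hθs hcrit hδ
      margin := fun r hr => by
        obtain ⟨η, hη, h⟩ := hmargin r hr
        -- The margin is known relative to `f θ₀`; half of it absorbs the difference between
        -- `f_n(θ_n)` and its limit `f θ₀`.
        refine ⟨η / 2, half_pos hη, ?_⟩
        filter_upwards [h, hval.eventually (gt_mem_nhds (show f θ₀ < f θ₀ + η / 2 by linarith))]
          with n h1 h2 θ hθ hr
        linarith [h1 θ hθ hr] }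
  refine ⟨θs, fun n => hEΘ (hθsE n), hθs, ?_, hval, hset.eventually_integrable_and_pos,
    fun ε hε => hset.tendsto_integral_ball hε, hset.tendsto_normConst_div hH hquad,
    hset.tendsto_lintegral_abs_sub_normalDensity hH hquad⟩
  filter_upwards [hcrit, hf3'] with n h1 h2
  have h3 := ((h2.contDiffAt (hEo.mem_nhds (hθsE n))).differentiableAt (by norm_num)).hasFDerivAt
  rw [h1] at h3
  rw [hasGradientAt_iff_hasFDerivAt]
  simpa using h3
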